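/- Composition is written in diagrammatic order. A *universe category* $(\mathcal C,p)$ is a category $\mathcal C$ with a chosen final object $pt$, a morphism $p:\widetilde U\to U$ and, for every $F:X\to U$, a chosen pull-back $(X;F)$ of $p$ along $F$, with projections $p_{X,F}:(X;F)\to X$ and $Q(F):(X;F)\to\widetilde U$. For $f:W\to X$ and $g:W\to\widetilde U$ with $f\circ F=g\circ p$, $f*g:W\to(X;F)$ denotes the induced morphism. A *universe category functor* $\mathbf\Phi=(\Phi,\phi,\widetilde\phi):(\mathcal C,p)\to(\mathcal C',p')$ is a functor $\Phi:\mathcal C\to\mathcal C'$ that takes $pt$ to a final object and the chosen pull-back squares to pull-back squares, with morphisms $\phi:\Phi(U)\to U'$, $\widetilde\phi:\Phi(\widetilde U)\to\widetilde U'$ such that the square with sides $\widetilde\phi,\Phi(p),p',\phi$ is a pull-back square. **J-structures on universes.** A J0-structure on $p$ is a morphism $Eq:(\widetilde U;p)\to U$. Let $E\widetilde U=((\widetilde U;p);Eq)$, let $pE:E\widetilde U\to U$ be the composite projection, with the universe structure obtained by stacking three chosen squares of $p$. A J1-structure over $Eq$ is $\Omega:\widetilde U\to\widetilde U$ with $\Omega\circ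 p=\Delta\circ Eq$, where $\Delta=\mathrm{Id}*\mathrm{Id}$; put $\omega=\Delta*\Omega:\widetilde U\to E\widetilde U$. If $\mathcal C$ has a locally cartesian closed structure (chosen fiber products and relative internal Hom-objects), let $I_p(V)=\underline{Hom}_U((\widetilde U,p),(U\times V,pr_1))$, let $D_p(X,V)$ be the set of pairs $(F:X\to U,\ a:(X;F)\to V)$, let $\eta_p:D_p(X,V)\cong Hom(X,I_p(V))$ be the natural bijection, and likewise for $pE$; let $I^\omega(V):I_{pE}(V)\to I_p(V)$ be the morphism induced by $\omega$. A J2-structure over $(Eq,\Omega)$ is a morphism $Jp: I_{pE}(U)\times_{I_p(U)}I_p(\widetilde U)\to I_{pE}(\widetilde U)$ whose composition with the morphism $coJ: I_{pE}(\widetilde U)\to I_{pE}(U)\times_{I_p(U)}I_p(\widetilde U)$ with the components $I_{pE}(p)$ and $I^\omega(\widetilde U)$ is the identity, $Jp\circ coJ=\mathrm{Id}$; the fiber product is that of $I^\omega(U)$ and $I_p(p)$. **Compatibility.** $\mathbf\Phi$ is compatible with $Eq,Eq'$ if $\Phi(Eq)\circ\phi=\Phi\widetilde Up\circ Eq'$,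 where $\Phi\widetilde Up:\Phi((\widetilde U;p))\to(\widetilde U';p')$ is induced by $\widetilde\phi$ on both components. It is compatible with $\Omega,\Omega'$ if $\Phi(\Omega)\circ\widetilde\phi=\widetilde\phi\circ\Omega'$. Let $\widetilde\phi_E:\Phi(E\widetilde U)\to E\widetilde U'$ be induced by $\Phi\widetilde Up$ and $\widetilde\phi$. Let $\chi_{\mathbf\Phi}(V):\Phi(I_p(V))\to I_{p'}(\Phi(V))$ be the image under $\eta_{p'}$ of the element of $D_{p'}(\Phi(I_p(V)),\Phi(V))$ obtained by applying $\mathbf\Phi$ to the universal element of $D_p(I_p(V),V)$, and let $\chi_{\mathbf\Phi_E}$ be the analogous morphism for $\mathbf\Phi_E=(\Phi,\phi,\widetilde\phi_E)$ and $pE,pE'$. Then $\widetilde\xi=\chi_{\mathbf\Phi}(\widetilde U)\circ I_{p'}(\widetilde\phi)$, $\zeta=\chi_{\mathbf\Phi_E}(U)\circ I_{pE'}(\phi)$, $\widetilde\zeta=\chi_{\mathbf\Phi_E}(\widetilde U)\circ I_{pE'}(\widetilde\phi)$, and $\zeta,\widetilde\xi$ induce a morphism $R$ from $\Phi$ of the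 fiber product of $(\mathcal C,p)$ to the fiber product of $(\mathcal C',p')$. $\mathbf\Phi$ is compatible with $Jp,Jp'$ if it is compatible with $Eq,Eq'$ and $\Omega,\Omega'$ and $\Phi(Jp)\circ\widetilde\zeta=R\circ Jp'$. **C-systems.** $CC(\mathcal C,p)$ is the C-system whose objects of length $n$ are sequences $\Gamma=(F_1,\dots,F_n)$ of morphisms to $U$, with $int(())=pt$, $F_{i+1}:int(F_1,\dots,F_i)\to U$, $int(\Gamma,F)=(int(\Gamma);F)$, and with $Hom(\Gamma,\Gamma')=Hom_{\mathcal C}(int\,\Gamma,int\,\Gamma')$. $Ob_1(\Gamma)$ is the set of one-step extensions $T=(\Gamma,F)$, $u_1(T)=F$; $\widetilde{Ob}_1(\Gamma)$ is the set of pairs of $T\in Ob_1(\Gamma)$ and a section $s$ of $T\to\Gamma$, with $\partial(s)=T$ and $\widetilde u_1(s)=s\circ Q(u_1(T))$; $u_1$, $\widetilde u_1$ are bijections to $Hom(int\,\Gamma,U)$, $Hom(int\,\Gamma,\widetilde U)$. The functor $\mathbf\Phi$ defines a homomorphism of C-systems $H=H(\mathbf\Phi):CC(\mathcal C,p)\to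 CC(\mathcal C',p')$ by recursion, with isomorphisms $\psi_\Gamma:int'(H(\Gamma))\to\Phi(int(\Gamma))$: $H(())=()$, $H(\Gamma,F)=(H(\Gamma),\psi_\Gamma\circ\Phi(F)\circ\phi)$, $\psi_{(\Gamma,F)}$ is the unique morphism compatible with the projections and $Q$, and $H(f)=\psi_\Gamma\circ\Phi(f)\circ\psi_{\Gamma'}^{-1}$. A J0-structure on a C-system is an operation $IdT(o,o')\in Ob_1(\Gamma)$ for $o,o'\in\widetilde{Ob}_1(\Gamma)$ with $\partial o=\partial o'$; a J1-structure is an operation $refl(s)\in\widetilde{Ob}_1(\Gamma)$ with $\partial(refl(s))=IdT(s,s)$; a J2-structure is an operation $J(\Gamma,T,P,s_0)\in\widetilde{Ob}_1(IdxT(T))$ with $\partial J=P$ and $rf_T^*(J)=s_0$, for $T\in Ob_1(\Gamma)$, $P\in Ob_1(IdxT(T))$ and $s_0\in\widetilde{Ob}_1(T)$ with $\partial(s_0)=rf_T^*(P)$, where $IdxT(T)=(\Gamma,x:T,y:T,e:IdT(x,y))$ and $rf_T:T\to IdxT(T)$ is given by $refl$ of the diagonal; all are stable under pull-back. The structures on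 $CC(\mathcal C,p)$ induced by $Eq,\Omega,Jp$ are $u_1(IdT_{Eq}(o,o'))=(\widetilde u_1(o)*\widetilde u_1(o'))\circ Eq$, $\widetilde u_1(refl_\Omega(s))=\widetilde u_1(s)\circ\Omega$, and $\eta_{pE}(u_1(T),\widetilde u_1(J_{Jp}(\Gamma,T,P,s_0)))=\varphi\circ Jp$, where $\varphi$ has the components $\eta_{pE}(u_1(T),u_1(P))$ and $\eta_p(u_1(T),\widetilde u_1(s_0))$. **Lemma.** Let $\mathbf\Phi:(\mathcal C,p)\to(\mathcal C',p')$ be a universe category functor compatible with J0-structures $Eq$, $Eq'$. 1. $H(IdT_{Eq}(o,o'))=IdT_{Eq'}(H(o),H(o'))$ for all $\Gamma$ and all $o,o'\in\widetilde{Ob}_1(\Gamma)$ with $\partial o=\partial o'$; that is, $H$ is a homomorphism of C-systems with J0-structures. 2. If $\mathbf\Phi$ is also compatible with J1-structures $\Omega$, $\Omega'$ over $Eq$, $Eq'$, then in addition $H(refl_\Omega(s))=refl_{\Omega'}(H(s))$ for all $\Gamma$ and $s\in\widetilde{Ob}_1(\Gamma)$; that is, $H$ is a homomorphism of C-systems with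 (J0, J1)-structures. 3. If moreover $\mathcal C$, $\mathcal C'$ are equipped with locally cartesian closed structures and $\mathbf\Phi$ is compatible with J2-structures $Jp$, $Jp'$ over $(Eq,\Omega)$, $(Eq',\Omega')$, then in addition $H(J_{Jp}(\Gamma,T,P,s_0))=J_{Jp'}(H(\Gamma),H(T),H(P),H(s_0))$ for all $(\Gamma,T,P,s_0)$ as above; that is, $H$ is a homomorphism of C-systems with (J0, J1, J2)-structures. -/

import Mathlib

open CategoryTheory CategoryTheory.Limits

universe w w' v v' u u'

/-! ### C-systems -/

/-- The length function and the father function of a C-system. -/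
class CtxLength (CC : Type w) where
  len : CC → ℕ
  ft : CC → CC

/-- `Ob1 Γ` is the set of objects `T` of positive length with `ft T = Γ`. -/
@[ext]
structure Ob1 {CC : Type w} [CtxLength CC] (Γ : CC) where
  obj : CC
  len_pos : 0 < CtxLength.len obj
  ft_eq : CtxLength.ft obj = Γ

/-- A C-system: a category with a length function on objects, a father function `ft`, a
distinguished final object `pt`, canonical projections `proj T : T ⟶ ft T` for objects of positive
length, and strictly functorial canonical squares
`q f T : f^* T ⟶ T` over `f : Δ ⟶ ft T`, which are pull-back squares. The operation `g ↦ s_g`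
that is sometimes listed among the data of a C-system exists and is unique because the canonical
squares are pull-back squares. -/
class CSystem (CC : Type w) extends Category.{v} CC, CtxLength CC where
  pt : CC
  len_eq_zero : ∀ X : CC, len X = 0 ↔ X = pt
  len_ft : ∀ X : CC, 0 < len X → len (ft X) + 1 = len X
  ft_pt : ft pt = pt
  isTerminal : IsTerminal pt
  proj : ∀ {Γ : CC} (T : Ob1 Γ), T.obj ⟶ Γ
  pull : ∀ {Δ Γ : CC} (_ : Δ ⟶ Γ) (_ : Ob1 Γ), Ob1 Δ
  q : ∀ {Δ Γ : CC} (f : Δ ⟶ Γ) (T : Ob1 Γ), (pull f T).obj ⟶ T.obj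
  isPullback : ∀ {Δ Γ : CC} (f : Δ ⟶ Γ) (T : Ob1 Γ),
    IsPullback (q f T) (proj (pull f T)) (proj T) f
  pull_id : ∀ {Γ : CC} (T : Ob1 Γ), pull (𝟙 Γ) T = T
  q_id : ∀ {Γ : CC} (T : Ob1 Γ), q (𝟙 Γ) T = eqToHom (congrArg Ob1.obj (pull_id T))
  pull_comp : ∀ {Θ Δ Γ : CC} (g : Θ ⟶ Δ) (f : Δ ⟶ Γ) (T : Ob1 Γ),
    pull (g ≫ f) T = pull g (pull f T)
  q_comp : ∀ {Θ Δ Γ : CC} (g : Θ ⟶ Δ) (f : Δ ⟶ Γ) (T : Ob1 Γ),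
    q (g ≫ f) T = eqToHom (congrArg Ob1.obj (pull_comp g f T)) ≫ q g (pull f T) ≫ q f T

namespace CSystem

section Basic

variable {CC : Type w} [CSystem.{w, v} CC]

lemma proj_congr {Γ : CC} {T T' : Ob1 Γ} (h : T = T') :
    eqToHom (congrArg Ob1.obj h) ≫ proj T' = proj T := by
  subst h; simp

lemma q_congr {Δ Γ : CC} {f f' : Δ ⟶ Γ} (h : f = f') (T : Ob1 Γ) :
    q f T = eqToHom (by rw [h]) ≫ q f' T := by
  subst h; simp

lemma q_congr_ty {Δ Γ : CC} (f : Δ ⟶ Γ) {T T' : Ob1 Γ} (h : T = T') :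
    q f T ≫ eqToHom (by rw [h]) = eqToHom (by rw [h]) ≫ q f T' := by
  subst h; simp

/-- Elements of `Tm Γ` are the sections of canonical projections `T ⟶ Γ`, for `T` in `Ob1 Γ`. -/
structure Tm (Γ : CC) where
  ty : Ob1 Γ
  sec : Γ ⟶ ty.obj
  sec_proj : sec ≫ proj ty = 𝟙 Γ

lemma Tm.ext_sec {Γ : CC} {o o' : Tm Γ} (h : o.ty = o'.ty)
    (hs : o.sec ≫ eqToHom (congrArg Ob1.obj h) = o'.sec) : o = o' := by
  obtain ⟨T, s, hs1⟩ := o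
  obtain ⟨T', s', hs2⟩ := o'
  dsimp only at h
  subst h
  simp at hs
  subst hs
  rfl

/-- The section of `f^* T` obtained by pulling back a section of `T`. -/
noncomputable def Tm.pullSec {Δ Γ : CC} (f : Δ ⟶ Γ) (o : Tm Γ) :
    Δ ⟶ (CSystem.pull f o.ty).obj :=
  (isPullback f o.ty).lift (f ≫ o.sec) (𝟙 Δ) (by simp [o.sec_proj])

@[simp]
lemma Tm.pullSec_q {Δ Γ : CC} (f : Δ ⟶ Γ) (o : Tm Γ) :
    o.pullSec f ≫ q f o.ty = f ≫ o.sec := by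
  simp [Tm.pullSec]

@[simp]
lemma Tm.pullSec_q_assoc {Δ Γ : CC} (f : Δ ⟶ Γ) (o : Tm Γ) {K : CC} (k : o.ty.obj ⟶ K) :
    o.pullSec f ≫ q f o.ty ≫ k = f ≫ o.sec ≫ k := by
  simpa only [Category.assoc, Category.id_comp] using congrArg (fun t => t ≫ k) (o.pullSec_q f)

@[simp]
lemma Tm.pullSec_proj {Δ Γ : CC} (f : Δ ⟶ Γ) (o : Tm Γ) :
    o.pullSec f ≫ proj (CSystem.pull f o.ty) = 𝟙 Δ := by
  simp [Tm.pullSec]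

/-- The pull-back `f^* o` of a section along `f : Δ ⟶ Γ`. -/
noncomputable abbrev Tm.pull {Δ Γ : CC} (f : Δ ⟶ Γ) (o : Tm Γ) : Tm Δ where
  ty := CSystem.pull f o.ty
  sec := o.pullSec f
  sec_proj := o.pullSec_proj f

lemma Tm.eq_pull {Δ Γ : CC} (f : Δ ⟶ Γ) (o : Tm Γ) (o' : Tm Δ)
    (h : o'.ty = CSystem.pull f o.ty)
    (hs : o'.sec ≫ eqToHom (congrArg Ob1.obj h) ≫ q f o.ty = f ≫ o.sec) : o' = o.pull f := by
  refine Tm.ext_sec h ?_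
  apply (isPullback f o.ty).hom_ext
  · simp [hs]
  · simp [proj_congr h, o'.sec_proj]

lemma Tm.pull_id {Γ : CC} (o : Tm Γ) : o.pull (𝟙 Γ) = o := by
  symm
  apply Tm.eq_pull _ _ _ (CSystem.pull_id _).symm
  rw [q_id]; simp

lemma Tm.pull_comp {Θ Δ Γ : CC} (g : Θ ⟶ Δ) (f : Δ ⟶ Γ) (o : Tm Γ) :
    o.pull (g ≫ f) = (o.pull f).pull g := by
  symm
  apply Tm.eq_pull _ _ _ (CSystem.pull_comp _ _ _).symm
  rw [q_comp, eqToHom_trans_assoc, eqToHom_refl, Category.id_comp]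
  have := Tm.pullSec_q_assoc g (o.pull f) (q f o.ty)
  rw [Tm.pullSec_q] at this
  simpa using this

/-- The diagonal morphism `δ(T) : T ⟶ p_T^* T`. -/
noncomputable def diagSec {Γ : CC} (T : Ob1 Γ) : T.obj ⟶ (pull (proj T) T).obj :=
  (isPullback (proj T) T).lift (𝟙 _) (𝟙 _) rfl

@[simp] lemma diagSec_q {Γ : CC} (T : Ob1 Γ) :
    diagSec T ≫ q (proj T) T = 𝟙 _ := by simp [diagSec]

@[simp]
lemma diagSec_q_assoc {Γ : CC} (T : Ob1 Γ) {K : CC} (k : T.obj ⟶ K) :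
    diagSec T ≫ q (proj T) T ≫ k = k := by
  simpa only [Category.assoc, Category.id_comp] using congrArg (fun t => t ≫ k) (diagSec_q T)

@[simp] lemma diagSec_proj {Γ : CC} (T : Ob1 Γ) :
    diagSec T ≫ proj (pull (proj T) T) = 𝟙 _ := by simp [diagSec]

@[simp]
lemma diagSec_proj_assoc {Γ : CC} (T : Ob1 Γ) {K : CC} (k : T.obj ⟶ K) :
    diagSec T ≫ proj (pull (proj T) T) ≫ k = k := by
  simpa only [Category.assoc, Category.id_comp] using congrArg (fun t => t ≫ k) (diagSec_proj T)

/-- The diagonal `δ(T)` as a section of `p_T^* T` over `T`. -/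
noncomputable abbrev diag {Γ : CC} (T : Ob1 Γ) : Tm T.obj where
  ty := pull (proj T) T
  sec := diagSec T
  sec_proj := diagSec_proj T

/-- Pulling the diagonal of `∂(o)` back along the section `o` gives `o`. -/
lemma diag_pull_sec {Γ : CC} (o : Tm Γ) : (diag o.ty).pull o.sec = o := by
  symm
  have h : o.ty = pull o.sec (pull (proj o.ty) o.ty) := by
    rw [← CSystem.pull_comp, o.sec_proj, CSystem.pull_id]
  apply Tm.eq_pull _ _ _ h
  apply (isPullback (proj o.ty) o.ty).hom_ext
  · have h1 := q_comp o.sec (proj o.ty) o.ty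
    have h2 := q_congr o.sec_proj o.ty
    rw [q_id, eqToHom_trans] at h2
    rw [h2] at h1
    have h3 : q o.sec (pull (proj o.ty) o.ty) ≫ q (proj o.ty) o.ty =
        eqToHom (by rw [← h]) := by
      rw [← cancel_epi (eqToHom (congrArg Ob1.obj (CSystem.pull_comp o.sec (proj o.ty) o.ty))),
        ← h1, eqToHom_trans]
    simp [h3]
  · have h1 := (isPullback o.sec (pull (proj o.ty) o.ty)).w
    have h2 := proj_congr h
    simp only [Category.assoc, h1, diagSec_proj, Category.comp_id]
    rw [← Category.assoc (eqToHom _), h2, ← Category.assoc, o.sec_proj, Category.id_comp]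

/-- Naturality of the diagonal. -/
lemma diag_pull {Δ Γ : CC} (f : Δ ⟶ Γ) (T : Ob1 Γ) :
    (diag T).pull (q f T) = diag (pull f T) := by
  symm
  have hw := (isPullback f T).w
  have h : pull (proj (pull f T)) (pull f T) = pull (q f T) (pull (proj T) T) := by
    rw [← CSystem.pull_comp, ← CSystem.pull_comp, hw]
  apply Tm.eq_pull _ _ _ h
  apply (isPullback (proj T) T).hom_ext
  · have h1 := q_comp (q f T) (proj T) T
    have h2 := q_comp (proj (pull f T)) f T
    have h3 := q_congr hw T
    rw [h3, h2] at h1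
    have h4 : q (q f T) (pull (proj T) T) ≫ q (proj T) T = eqToHom (by rw [h]) ≫
        q (proj (pull f T)) (pull f T) ≫ q f T := by
      rw [← cancel_epi (eqToHom (congrArg Ob1.obj (CSystem.pull_comp (q f T) (proj T) T))), ← h1]
      simp
    simp [h4]
  · have h1 := (isPullback (q f T) (pull (proj T) T)).w
    have h2 := proj_congr h
    simp only [Category.assoc, h1, diagSec_proj, Category.comp_id]
    rw [← Category.assoc (eqToHom _), h2, diagSec_proj_assoc]

/-- The morphism `q(f, p_T^* T, 2)` between the double extensions. -/
def q2 {Δ Γ : CC} (f : Δ ⟶ Γ) (T : Ob1 Γ) :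
    (pull (proj (pull f T)) (pull f T)).obj ⟶ (pull (proj T) T).obj :=
  eqToHom (congrArg Ob1.obj (by
    rw [← CSystem.pull_comp, ← CSystem.pull_comp, (isPullback f T).w])) ≫
    q (q f T) (pull (proj T) T)

lemma Tm.sec_congr {Γ : CC} {o o' : Tm Γ} (e : o = o') :
    o.sec ≫ eqToHom (by rw [e]) = o'.sec := by
  subst e; simp

lemma diag_sec_q2 {Δ Γ : CC} (f : Δ ⟶ Γ) (T : Ob1 Γ) :
    diagSec (pull f T) ≫ q2 f T = q f T ≫ diagSec T := by
  have h := Tm.pullSec_q (q f T) (diag T)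
  have h' := Tm.sec_congr (diag_pull f T).symm
  dsimp only at h h'
  rw [← h, ← h']
  simp [q2]

lemma q2_proj {Δ Γ : CC} (f : Δ ⟶ Γ) (T : Ob1 Γ) :
    q2 f T ≫ proj (pull (proj T) T) = proj (pull (proj (pull f T)) (pull f T)) ≫ q f T := by
  have h : pull (proj (pull f T)) (pull f T) = pull (q f T) (pull (proj T) T) := by
    rw [← CSystem.pull_comp, ← CSystem.pull_comp, (isPullback f T).w]
  have h1 := (isPullback (q f T) (pull (proj T) T)).w
  simp only [q2, Category.assoc, h1]
  rw [← Category.assoc, proj_congr h]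

lemma diag_pull_eqToHom {Γ : CC} {A B : Ob1 Γ} (h : A = B) :
    (diag B).pull (eqToHom (congrArg Ob1.obj h)) = diag A := by
  subst h; exact Tm.pull_id _

lemma diag_pull_q2 {Δ Γ : CC} (f : Δ ⟶ Γ) (T : Ob1 Γ) :
    (diag (pull (proj T) T)).pull (q2 f T) =
      diag (pull (proj (pull f T)) (pull f T)) := by
  rw [q2, Tm.pull_comp, diag_pull, diag_pull_eqToHom]
  rw [← CSystem.pull_comp, ← CSystem.pull_comp, (isPullback f T).w]

end Basic

/-! ### J-structures on C-systems -/

/-- A J0-structure on a C-system. -/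
structure J0 (CC : Type w) [CSystem.{w, v} CC] where
  IdT : ∀ {Γ : CC} (o o' : Tm Γ), o.ty = o'.ty → Ob1 Γ
  natural : ∀ {Δ Γ : CC} (f : Δ ⟶ Γ) (o o' : Tm Γ) (h : o.ty = o'.ty),
    pull f (IdT o o' h) = IdT (o.pull f) (o'.pull f) (congrArg (pull f) h)

section J0

variable {CC : Type w} [CSystem.{w, v} CC]

lemma J0.congr (I : J0 CC) {Γ : CC} {o₁ o₂ o₁' o₂' : Tm Γ} (h : o₁ = o₂) (h' : o₁' = o₂')
    (e : o₁.ty = o₁'.ty) (e' : o₂.ty = o₂'.ty) : I.IdT o₁ o₁' e = I.IdT o₂ o₂' e' := by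
  subst h h'; rfl

/-- The object `IdxT(T)`, that is the context `(Γ, x : T, y : T, e : IdT x y)`. -/
noncomputable def J0.IdxT (I : J0 CC) {Γ : CC} (T : Ob1 Γ) : Ob1 (pull (proj T) T).obj :=
  I.IdT ((diag T).pull (proj (pull (proj T) T))) (diag (pull (proj T) T)) rfl

lemma J0.diag_pull_IdxT (I : J0 CC) {Γ : CC} (T : Ob1 Γ) :
    pull (diagSec T) (I.IdxT T) = I.IdT (diag T) (diag T) rfl := by
  rw [J0.IdxT, I.natural]
  apply J0.congr
  · rw [← Tm.pull_comp, diagSec_proj, Tm.pull_id]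
  · exact diag_pull_sec (diag T)

lemma J0.IdxT_natural (I : J0 CC) {Δ Γ : CC} (f : Δ ⟶ Γ) (T : Ob1 Γ) :
    I.IdxT (pull f T) = pull (q2 f T) (I.IdxT T) := by
  rw [J0.IdxT, J0.IdxT, I.natural]
  apply J0.congr
  · rw [← Tm.pull_comp, q2_proj, Tm.pull_comp, diag_pull]
  · exact (diag_pull_q2 f T).symm

/-- The morphism `q(f, IdxT(T), 3) : IdxT(f^* T) ⟶ IdxT(T)`. -/
noncomputable def J0.q3 (I : J0 CC) {Δ Γ : CC} (f : Δ ⟶ Γ) (T : Ob1 Γ) :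
    (I.IdxT (pull f T)).obj ⟶ (I.IdxT T).obj :=
  eqToHom (congrArg Ob1.obj (I.IdxT_natural f T)) ≫ q (q2 f T) (I.IdxT T)

end J0

/-- A J1-structure over a J0-structure on a C-system. -/
structure J1 {CC : Type w} [CSystem.{w, v} CC] (I : J0 CC) where
  refl : ∀ {Γ : CC}, Tm Γ → Tm Γ
  natural : ∀ {Δ Γ : CC} (f : Δ ⟶ Γ) (o : Tm Γ), (refl o).pull f = refl (o.pull f)
  ty_refl : ∀ {Γ : CC} (o : Tm Γ), (refl o).ty = I.IdT o o rfl

section J1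

variable {CC : Type w} [CSystem.{w, v} CC] {I : J0 CC}

/-- The morphism `rf_T : T ⟶ IdxT(T)`. -/
noncomputable def J1.rf (R : J1 I) {Γ : CC} (T : Ob1 Γ) : T.obj ⟶ (I.IdxT T).obj :=
  (R.refl (diag T)).sec ≫
    eqToHom (congrArg Ob1.obj ((R.ty_refl (diag T)).trans (I.diag_pull_IdxT T).symm)) ≫
    q (diagSec T) (I.IdxT T)

lemma J1.rf_natural (R : J1 I) {Δ Γ : CC} (f : Δ ⟶ Γ) (T : Ob1 Γ) :
    R.rf (pull f T) ≫ I.q3 f T = q f T ≫ R.rf T := by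
  have e : (R.refl (diag T)).pull (q f T) = R.refl (diag (pull f T)) := by
    rw [R.natural, diag_pull]
  have e' := Tm.sec_congr e
  dsimp only at e'
  have hty : (R.refl (diag T)).ty = pull (diagSec T) (I.IdxT T) :=
    (R.ty_refl (diag T)).trans (I.diag_pull_IdxT T).symm
  have h1 := Tm.pullSec_q (q f T) (R.refl (diag T))
  have h2 := q_congr_ty (q f T) hty
  have h3 := q_comp (q f T) (diagSec T) (I.IdxT T)
  have h4 := q_comp (diagSec (pull f T)) (q2 f T) (I.IdxT T)
  have h5 := q_congr (diag_sec_q2 f T) (I.IdxT T)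
  have h6 := q_congr_ty (diagSec (pull f T)) (I.IdxT_natural f T)
  unfold J1.rf J0.q3
  rw [← Category.assoc (q f T), ← h1, ← e']
  simp only [Category.assoc]
  rw [reassoc_of% h2, reassoc_of% h6]
  have h7 : q (diagSec (pull f T)) (pull (q2 f T) (I.IdxT T)) ≫ q (q2 f T) (I.IdxT T) =
      eqToHom (congrArg Ob1.obj ((CSystem.pull_comp _ _ _).symm.trans
        ((congrArg (fun g => pull g (I.IdxT T)) (diag_sec_q2 f T)).trans
          (CSystem.pull_comp _ _ _)))) ≫
        q (q f T) (pull (diagSec T) (I.IdxT T)) ≫ q (diagSec T) (I.IdxT T) := by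
    rw [← cancel_epi (eqToHom (congrArg Ob1.obj
      (CSystem.pull_comp (diagSec (pull f T)) (q2 f T) (I.IdxT T)))), ← h4, h5, h3]
    simp
  rw [h7]
  simp

end J1

/-- A J2-structure over a J0-structure and a J1-structure on a C-system. The hypothesis of `J` says
that `s0` is a section of `rf_T^* P`. -/
structure J2 {CC : Type w} [CSystem.{w, v} CC] {I : J0 CC} (R : J1 I) where
  J : ∀ {Γ : CC} (T : Ob1 Γ) (P : Ob1 (I.IdxT T).obj) (s0 : Tm T.obj),
    s0.ty = pull (R.rf T) P → Tm (I.IdxT T).obj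
  ty_J : ∀ {Γ : CC} (T : Ob1 Γ) (P : Ob1 (I.IdxT T).obj) (s0 : Tm T.obj)
    (h : s0.ty = pull (R.rf T) P), (J T P s0 h).ty = P
  natural : ∀ {Δ Γ : CC} (f : Δ ⟶ Γ) (T : Ob1 Γ) (P : Ob1 (I.IdxT T).obj) (s0 : Tm T.obj)
    (h : s0.ty = pull (R.rf T) P),
    (J T P s0 h).pull (I.q3 f T) =
      J (pull f T) (pull (I.q3 f T) P) (s0.pull (q f T))
        (by
          change pull (q f T) s0.ty = _
          rw [h, ← CSystem.pull_comp, ← CSystem.pull_comp, R.rf_natural])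
  iota : ∀ {Γ : CC} (T : Ob1 Γ) (P : Ob1 (I.IdxT T).obj) (s0 : Tm T.obj)
    (h : s0.ty = pull (R.rf T) P), (J T P s0 h).pull (R.rf T) = s0

/-! ### Homomorphisms of C-systems -/

/-- A functor commuting with lengths and father functions. -/
structure LengthFunctor (CC : Type w) [CSystem.{w, v} CC] (CC' : Type w') [CSystem.{w', v'} CC']
    extends CC ⥤ CC' where
  len_obj : ∀ X : CC, CtxLength.len (obj X) = CtxLength.len X
  ft_obj : ∀ X : CC, CtxLength.ft (obj X) = obj (CtxLength.ft X)

/-- The map `Ob1 Γ → Ob1 (H Γ)`. -/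
abbrev LengthFunctor.ob1 {CC : Type w} [CSystem.{w, v} CC] {CC' : Type w'} [CSystem.{w', v'} CC']
    (H : LengthFunctor CC CC') {Γ : CC} (T : Ob1 Γ) : Ob1 (H.obj Γ) where
  obj := H.obj T.obj
  len_pos := by rw [H.len_obj]; exact T.len_pos
  ft_eq := by rw [H.ft_obj, T.ft_eq]

/-- A homomorphism of C-systems: a functor that strictly preserves all the structure. (It preserves
`pt`, the only object of length zero.) -/
structure CHom (CC : Type w) [CSystem.{w, v} CC] (CC' : Type w') [CSystem.{w', v'} CC']
    extends LengthFunctor CC CC' where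
  map_proj : ∀ {Γ : CC} (T : Ob1 Γ), map (proj T) = proj (toLengthFunctor.ob1 T)
  ob1_pull : ∀ {Δ Γ : CC} (f : Δ ⟶ Γ) (T : Ob1 Γ),
    toLengthFunctor.ob1 (pull f T) = pull (map f) (toLengthFunctor.ob1 T)
  map_q : ∀ {Δ Γ : CC} (f : Δ ⟶ Γ) (T : Ob1 Γ),
    map (q f T) = eqToHom (congrArg Ob1.obj (ob1_pull f T)) ≫ q (map f) (toLengthFunctor.ob1 T)

/-- Transport of `Ob1` along an equality of objects; the underlying object is unchanged. -/
abbrev _root_.Ob1.cast {CC : Type w} [CtxLength CC] {Γ Γ' : CC} (e : Γ = Γ') (T : Ob1 Γ) :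
    Ob1 Γ' where
  obj := T.obj
  len_pos := T.len_pos
  ft_eq := T.ft_eq.trans e

/-- Transport of `Tm` along an equality of objects. -/
def Tm.cast {CC : Type w} [CSystem.{w, v} CC] {Γ Γ' : CC} (e : Γ = Γ') (o : Tm Γ) : Tm Γ' :=
  e ▸ o

section HomSec

variable {CC : Type w} [CSystem.{w, v} CC] {CC' : Type w'} [CSystem.{w', v'} CC']

/-- The map `Tm Γ → Tm (H Γ)`. -/
abbrev CHom.tm (H : CHom CC CC') {Γ : CC} (o : Tm Γ) : Tm (H.obj Γ) where
  ty := H.ob1 o.ty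
  sec := H.map o.sec
  sec_proj := by rw [← H.map_proj, ← H.map_comp, o.sec_proj, H.map_id]

lemma CHom.tm_pull (H : CHom CC CC') {Δ Γ : CC} (f : Δ ⟶ Γ) (o : Tm Γ) :
    H.tm (o.pull f) = (H.tm o).pull (H.map f) := by
  apply Tm.eq_pull _ _ _ (H.ob1_pull f o.ty)
  have h := H.map_q f o.ty
  dsimp only
  rw [← h, ← H.map_comp, ← H.map_comp, Tm.pullSec_q]

lemma CHom.tm_diag (H : CHom CC CC') {Γ : CC} (T : Ob1 Γ) :
    H.tm (diag T) = diag (H.ob1 T) := by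
  have h : H.ob1 (pull (proj T) T) = pull (proj (H.ob1 T)) (H.ob1 T) := by
    rw [H.ob1_pull, H.map_proj]
  apply Tm.ext_sec h
  apply (isPullback (proj (H.ob1 T)) (H.ob1 T)).hom_ext
  · have h1 := H.map_q (proj T) T
    have h2 := q_congr (H.map_proj T) (H.ob1 T)
    rw [h2, eqToHom_trans_assoc] at h1
    have h3 := congrArg H.map (diagSec_q T)
    rw [H.map_comp, H.map_id, h1] at h3
    simpa using h3
  · have h1 := congrArg H.map (diagSec_proj T)
    rw [H.map_comp, H.map_id, H.map_proj, ← proj_congr h] at h1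
    simpa using h1

/-- Homomorphisms of C-systems with J0-structures. -/
structure IsJ0Hom (H : CHom CC CC') (I : J0 CC) (I' : J0 CC') : Prop where
  map_IdT : ∀ {Γ : CC} (o o' : Tm Γ) (h : o.ty = o'.ty),
    H.ob1 (I.IdT o o' h) = I'.IdT (H.tm o) (H.tm o') (congrArg H.ob1 h)

/-- Homomorphisms of C-systems with J1-structures. -/
structure IsJ1Hom (H : CHom CC CC') {I : J0 CC} {I' : J0 CC'} (R : J1 I) (R' : J1 I') : Prop
    extends IsJ0Hom H I I' where
  map_refl : ∀ {Γ : CC} (o : Tm Γ), H.tm (R.refl o) = R'.refl (H.tm o)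

lemma IsJ0Hom.ob1_IdxT {H : CHom CC CC'} {I : J0 CC} {I' : J0 CC'} (hH : IsJ0Hom H I I')
    {Γ : CC} (T : Ob1 Γ) :
    H.ob1 (I.IdxT T) = pull (eqToHom (congrArg Ob1.obj (by
      change H.ob1 (pull (proj T) T) = _
      rw [H.ob1_pull, H.map_proj]))) (I'.IdxT (H.ob1 T)) := by
  have key : ∀ (X : Ob1 (H.obj T.obj)) (h : X = pull (proj (H.ob1 T)) (H.ob1 T)),
      I'.IdT ((diag (H.ob1 T)).pull (proj X)) (diag X) (by rw [h]) =
        pull (eqToHom (congrArg Ob1.obj h)) (I'.IdxT (H.ob1 T)) := by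
    rintro _ rfl
    rw [eqToHom_refl, CSystem.pull_id]
    rfl
  have h : H.ob1 (pull (proj T) T) = pull (proj (H.ob1 T)) (H.ob1 T) := by
    rw [H.ob1_pull, H.map_proj]
  rw [← key _ h, J0.IdxT, hH.map_IdT]
  apply J0.congr
  · rw [CHom.tm_pull, CHom.tm_diag, H.map_proj]
  · exact CHom.tm_diag _ _

lemma pull_eqToHom_obj {Γ Γ' : CC} (e : Γ = Γ') (T : Ob1 Γ') :
    (pull (eqToHom e) T).obj = T.obj := by
  subst e; rw [eqToHom_refl, CSystem.pull_id]

/-- A homomorphism of C-systems with J0-structures takes `IdxT(T)` to `IdxT'(H(T))`. -/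
lemma IsJ0Hom.obj_IdxT {H : CHom CC CC'} {I : J0 CC} {I' : J0 CC'} (hH : IsJ0Hom H I I')
    {Γ : CC} (T : Ob1 Γ) : H.obj (I.IdxT T).obj = (I'.IdxT (H.ob1 T)).obj := by
  have h := congrArg Ob1.obj (hH.ob1_IdxT T)
  rw [pull_eqToHom_obj] at h
  exact h

/-- A homomorphism of C-systems with J1-structures takes `rf_T` to `rf'_{H(T)}`. -/
lemma IsJ1Hom.map_rf {H : CHom CC CC'} {I : J0 CC} {I' : J0 CC'} {R : J1 I} {R' : J1 I'}
    (hH : IsJ1Hom H R R') {Γ : CC} (T : Ob1 Γ) :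
    H.map (R.rf T) ≫ eqToHom (hH.obj_IdxT T) = R'.rf (H.ob1 T) := by
  have h1 : H.ob1 (pull (proj T) T) = pull (proj (H.ob1 T)) (H.ob1 T) := by
    rw [H.ob1_pull, H.map_proj]
  have hd := Tm.sec_congr (H.tm_diag T)
  dsimp only at hd
  have hr := Tm.sec_congr ((hH.map_refl (diag T)).trans (congrArg R'.refl (H.tm_diag T)))
  dsimp only at hr
  have key : ∀ (X : Ob1 (H.obj T.obj)) (h : X = pull (proj (H.ob1 T)) (H.ob1 T))
      (d : H.obj T.obj ⟶ X.obj)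
      (_ : d ≫ eqToHom (congrArg Ob1.obj h) = diagSec (H.ob1 T))
      (Y : Ob1 X.obj)
      (hY : Y = pull (eqToHom (congrArg Ob1.obj h)) (I'.IdxT (H.ob1 T)))
      (e1 : (pull d Y).obj = (pull (diagSec (H.ob1 T)) (I'.IdxT (H.ob1 T))).obj)
      (e2 : Y.obj = (I'.IdxT (H.ob1 T)).obj),
      q d Y ≫ eqToHom e2 = eqToHom e1 ≫ q (diagSec (H.ob1 T)) (I'.IdxT (H.ob1 T)) := by
    rintro _ rfl d hd _ rfl e1 e2
    simp only [eqToHom_refl, Category.comp_id] at hd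
    subst hd
    have := q_congr_ty (diagSec (H.ob1 T)) (CSystem.pull_id (I'.IdxT (H.ob1 T)))
    exact this
  have hk := key (H.ob1 (pull (proj T) T)) h1 (H.map (diagSec T)) hd
    (H.ob1 (I.IdxT T)) (hH.ob1_IdxT T)
    (by
      rw [← H.ob1_pull, I.diag_pull_IdxT, I'.diag_pull_IdxT, hH.map_IdT]
      exact congrArg Ob1.obj (I'.congr (H.tm_diag T) (H.tm_diag T) _ _))
    (hH.obj_IdxT T)
  unfold J1.rf
  simp only [H.map_comp, eqToHom_map, H.map_q, Category.assoc]
  rw [← hr]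
  erw [hk]
  simp

lemma pull_eqToHom_cast {Γ Γ' : CC} (e : Γ = Γ') (T : Ob1 Γ) :
    pull (eqToHom e) (T.cast e) = T := by
  subst e; rw [eqToHom_refl, CSystem.pull_id]

/-- If `s0` is a section of `rf_T^* P` then `H(s0)` is a section of `rf'_{H(T)}^* H(P)`. -/
lemma IsJ1Hom.ty_tm {H : CHom CC CC'} {I : J0 CC} {I' : J0 CC'} {R : J1 I} {R' : J1 I'}
    (hH : IsJ1Hom H R R') {Γ : CC} (T : Ob1 Γ) (P : Ob1 (I.IdxT T).obj) (s0 : Tm T.obj)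
    (h : s0.ty = pull (R.rf T) P) :
    (H.tm s0).ty = pull (R'.rf (H.ob1 T)) ((H.ob1 P).cast (hH.obj_IdxT T)) := by
  rw [← hH.map_rf, CSystem.pull_comp, pull_eqToHom_cast, ← H.ob1_pull]
  exact congrArg H.ob1 h

/-- Homomorphisms of C-systems with J-structures (consisting of a J0-, a J1- and a J2-structure). -/
structure IsJ2Hom (H : CHom CC CC') {I : J0 CC} {I' : J0 CC'} {R : J1 I} {R' : J1 I'}
    (S : J2 R) (S' : J2 R') : Prop extends IsJ1Hom H R R' where
  map_J : ∀ {Γ : CC} (T : Ob1 Γ) (P : Ob1 (I.IdxT T).obj) (s0 : Tm T.obj)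
    (h : s0.ty = pull (R.rf T) P),
    (H.tm (S.J T P s0 h)).cast (toIsJ1Hom.obj_IdxT T) =
      S'.J (H.ob1 T) ((H.ob1 P).cast (toIsJ1Hom.obj_IdxT T)) (H.tm s0)
        (toIsJ1Hom.ty_tm T P s0 h)

end HomSec

end CSystem

/-! ### Universes in categories and locally cartesian closed structures -/

section Universes

variable {C : Type u} [Category.{v} C]

/-- A universe structure on `p : Ut ⟶ U`: a choice, for every `F : X ⟶ U`, of a pull-back
`ext F`, also written `(X; F)`, of `p` along `F`, with the projections `pr F : (X; F) ⟶ X` and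
`Q F : (X; F) ⟶ Ut`. -/
structure UnivStr {U Ut : C} (p : Ut ⟶ U) where
  ext : ∀ {X : C}, (X ⟶ U) → C
  pr : ∀ {X : C} (F : X ⟶ U), ext F ⟶ X
  Q : ∀ {X : C} (F : X ⟶ U), ext F ⟶ Ut
  isPullback : ∀ {X : C} (F : X ⟶ U), IsPullback (Q F) (pr F) p F

namespace UnivStr

variable {U Ut : C} {p : Ut ⟶ U} (P : UnivStr p)

/-- The morphism `f * g : W ⟶ (X; F)`. -/
noncomputable def pair {W X : C} {F : X ⟶ U} (f : W ⟶ X) (g : W ⟶ Ut) (h : f ≫ F = g ≫ p) :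
    W ⟶ P.ext F :=
  (P.isPullback F).lift g f h.symm

@[simp]
lemma pair_pr {W X : C} {F : X ⟶ U} (f : W ⟶ X) (g : W ⟶ Ut) (h : f ≫ F = g ≫ p) :
    P.pair f g h ≫ P.pr F = f := by simp [pair]

@[simp]
lemma pair_pr_assoc {W X : C} {F : X ⟶ U} (f : W ⟶ X) (g : W ⟶ Ut) (h : f ≫ F = g ≫ p)
    {K : C} (k : X ⟶ K) :
    P.pair f g h ≫ P.pr F ≫ k = f ≫ k := by
  simpa only [Category.assoc, Category.id_comp] using congrArg (fun t => t ≫ k) (P.pair_pr f g h)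

@[simp]
lemma pair_Q {W X : C} {F : X ⟶ U} (f : W ⟶ X) (g : W ⟶ Ut) (h : f ≫ F = g ≫ p) :
    P.pair f g h ≫ P.Q F = g := by simp [pair]

lemma hom_ext {W X : C} {F : X ⟶ U} {f g : W ⟶ P.ext F} (h1 : f ≫ P.pr F = g ≫ P.pr F)
    (h2 : f ≫ P.Q F = g ≫ P.Q F) : f = g :=
  (P.isPullback F).hom_ext h2 h1

lemma w {X : C} (F : X ⟶ U) : P.Q F ≫ p = P.pr F ≫ F := (P.isPullback F).w

/-- The morphism `Q(f, F) : (X'; f ≫ F) ⟶ (X; F)`. -/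
noncomputable def Qm {X' X : C} (f : X' ⟶ X) (F : X ⟶ U) : P.ext (f ≫ F) ⟶ P.ext F :=
  P.pair (P.pr (f ≫ F) ≫ f) (P.Q (f ≫ F)) (by simp [P.w])

@[simp]
lemma Qm_pr {X' X : C} (f : X' ⟶ X) (F : X ⟶ U) :
    P.Qm f F ≫ P.pr F = P.pr (f ≫ F) ≫ f := by simp [Qm]

@[simp]
lemma Qm_pr_assoc {X' X : C} (f : X' ⟶ X) (F : X ⟶ U) {K : C} (k : X ⟶ K) :
    P.Qm f F ≫ P.pr F ≫ k = P.pr (f ≫ F) ≫ f ≫ k := by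
  simpa only [Category.assoc, Category.id_comp] using congrArg (fun t => t ≫ k) (P.Qm_pr f F)

@[simp]
lemma Qm_Q {X' X : C} (f : X' ⟶ X) (F : X ⟶ U) :
    P.Qm f F ≫ P.Q F = P.Q (f ≫ F) := by simp [Qm]

lemma isPullback_Qm {X' X : C} (f : X' ⟶ X) (F : X ⟶ U) :
    IsPullback (P.Qm f F) (P.pr (f ≫ F)) (P.pr F) f :=
  IsPullback.of_right (by simpa using P.isPullback (f ≫ F)) (P.Qm_pr f F) (P.isPullback F)

/-- The comparison between `(X; F)` and `(X; F')` for equal `F` and `F'`. -/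
noncomputable def trans {X : C} {F F' : X ⟶ U} (h : F = F') : P.ext F ⟶ P.ext F' :=
  P.pair (P.pr F) (P.Q F) (by rw [← h, P.w])

@[simp]
lemma trans_pr {X : C} {F F' : X ⟶ U} (h : F = F') : P.trans h ≫ P.pr F' = P.pr F := by
  simp [trans]

@[simp]
lemma trans_pr_assoc {X : C} {F F' : X ⟶ U} (h : F = F') {K : C} (k : X ⟶ K) :
    P.trans h ≫ P.pr F' ≫ k = P.pr F ≫ k := by
  simpa only [Category.assoc, Category.id_comp] using congrArg (fun t => t ≫ k) (P.trans_pr h)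

@[simp]
lemma trans_Q {X : C} {F F' : X ⟶ U} (h : F = F') : P.trans h ≫ P.Q F' = P.Q F := by
  simp [trans]

lemma trans_refl {X : C} (F : X ⟶ U) : P.trans (rfl : F = F) = 𝟙 _ :=
  P.hom_ext (by simp) (by simp)

/-- For universes `p : Ut ⟶ U` and `p' : Ut' ⟶ U` and `g : Ut' ⟶ Ut` over `U`, the morphism
`F^*(g) : (X; F)' ⟶ (X; F)`. -/
noncomputable def star {Ut' : C} {p' : Ut' ⟶ U} (P' : UnivStr p') (g : Ut' ⟶ Ut)
    (hg : g ≫ p = p') {X : C} (F : X ⟶ U) : P'.ext F ⟶ P.ext F :=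
  P.pair (P'.pr F) (P'.Q F ≫ g) (by rw [Category.assoc, hg, P'.w])

/-- The set `D_p(X, V)` of pairs of `F : X ⟶ U` and `a : (X; F) ⟶ V`. -/
abbrev D (X V : C) := Σ F : X ⟶ U, (P.ext F ⟶ V)

lemma D_ext {X V : C} {d d' : P.D X V} (h : d.1 = d'.1) (h2 : d.2 = P.trans h ≫ d'.2) :
    d = d' := by
  obtain ⟨F, a⟩ := d
  obtain ⟨F', a'⟩ := d'
  dsimp only at h
  subst h
  rw [trans_refl, Category.id_comp] at h2
  dsimp only at h2
  subst h2
  rfl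

lemma D_snd_eq {X V : C} {d d' : P.D X V} (h : d = d') :
    d.2 = P.trans (congrArg Sigma.fst h) ≫ d'.2 := by
  subst h
  rw [trans_refl, Category.id_comp]

/-- Contravariant functoriality of `D_p(X, V)` in `X`. -/
noncomputable abbrev Dpre {X' X V : C} (f : X' ⟶ X) (d : P.D X V) : P.D X' V :=
  ⟨f ≫ d.1, P.Qm f d.1 ≫ d.2⟩

/-- Covariant functoriality of `D_p(X, V)` in `V`. -/
abbrev Dmap {X V V' : C} (k : V ⟶ V') (d : P.D X V) : P.D X V' :=
  ⟨d.1, d.2 ≫ k⟩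

/-- The map `D^g(X, V) : D_p(X, V) → D_{p'}(X, V)` for `g : Ut' ⟶ Ut` over `U`. -/
noncomputable abbrev Dstar {Ut' : C} {p' : Ut' ⟶ U} (P' : UnivStr p') (g : Ut' ⟶ Ut)
    (hg : g ≫ p = p') {X V : C} (d : P.D X V) : P'.D X V :=
  ⟨d.1, P.star P' g hg d.1 ≫ d.2⟩

/-- The element of `D_p(X, V)` given by a morphism to `V` from an arbitrary pull-back of `p`
along `F : X ⟶ U`, which is identified with `(X; F)` through the canonical comparison. -/
noncomputable def mkD {X V Z : C} {F : X ⟶ U} {z : Z ⟶ Ut} {z' : Z ⟶ X}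
    (sq : IsPullback z z' p F) (a : Z ⟶ V) : P.D X V :=
  ⟨F, sq.lift (P.Q F) (P.pr F) (P.w F) ≫ a⟩

section mkD

variable {X V Z : C} {F : X ⟶ U} {z : Z ⟶ Ut} {z' : Z ⟶ X} (sq : IsPullback z z' p F)

lemma mkD_injective {a b : Z ⟶ V} (h : P.mkD sq a = P.mkD sq b) : a = b := by
  have h2 := P.D_snd_eq h
  simp only [mkD] at h2
  have e : P.pair z' z sq.w.symm ≫ sq.lift (P.Q F) (P.pr F) (P.w F) = 𝟙 _ := by
    apply sq.hom_ext <;> simp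
  have h3 : sq.lift (P.Q F) (P.pr F) (P.w F) ≫ a = sq.lift (P.Q F) (P.pr F) (P.w F) ≫ b := by
    have e2 := P.trans_refl F
    refine h2.trans ?_
    exact (congrArg (fun t => t ≫ sq.lift (P.Q F) (P.pr F) (P.w F) ≫ b) e2).trans
      (Category.id_comp _)
  have h4 := congrArg (fun t => P.pair z' z sq.w.symm ≫ t) h3
  simpa [reassoc_of% e] using h4

lemma mkD_Dmap {V' : C} (a : Z ⟶ V) (k : V ⟶ V') :
    P.Dmap k (P.mkD sq a) = P.mkD sq (a ≫ k) := by
  simp [mkD, Dmap]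

lemma mkD_Dpre {X' Z₁ : C} (f : X' ⟶ X) {z₁ : Z₁ ⟶ Ut} {z₁' : Z₁ ⟶ X'}
    (sq₁ : IsPullback z₁ z₁' p (f ≫ F)) (r : Z₁ ⟶ Z) (h1 : r ≫ z = z₁) (h2 : r ≫ z' = z₁' ≫ f)
    (a : Z ⟶ V) : P.Dpre f (P.mkD sq a) = P.mkD sq₁ (r ≫ a) := by
  refine P.D_ext rfl ?_
  refine Eq.trans ?_ ((congrArg (fun t => t ≫ _) (P.trans_refl (f ≫ F))).trans
      (Category.id_comp _)).symm
  simp only [mkD, ← Category.assoc]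
  congr 1
  apply sq.hom_ext <;> simp [h1, h2]

lemma mkD_Dstar {Ut' Z₁ : C} {p' : Ut' ⟶ U} (P' : UnivStr p') (g : Ut' ⟶ Ut)
    (hg : g ≫ p = p') {z₁ : Z₁ ⟶ Ut'} {z₁' : Z₁ ⟶ X}
    (sq₁ : IsPullback z₁ z₁' p' F) (r : Z₁ ⟶ Z) (h1 : r ≫ z = z₁ ≫ g) (h2 : r ≫ z' = z₁')
    (a : Z ⟶ V) : P.Dstar P' g hg (P.mkD sq a) = P'.mkD sq₁ (r ≫ a) := by
  refine P'.D_ext rfl ?_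
  refine Eq.trans ?_ ((congrArg (fun t => t ≫ _) (P'.trans_refl F)).trans
      (Category.id_comp _)).symm
  simp only [mkD, ← Category.assoc]
  congr 1
  apply sq.hom_ext <;> simp [h1, h2, star]

/-- The morphism from an arbitrary pull-back of `p` along `F` given by an element of `D_p(X, V)`
whose first component is `F`. -/
noncomputable def unD (d : P.D X V) (h : d.1 = F) : Z ⟶ V :=
  P.pair z' z (by rw [h]; exact sq.w.symm) ≫ d.2

lemma mkD_unD (d : P.D X V) (h : d.1 = F) : P.mkD sq (P.unD sq d h) = d := by
  obtain ⟨F', a⟩ := d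
  dsimp only at h
  subst h
  refine P.D_ext rfl ?_
  simp only [mkD, unD, trans_refl, ← Category.assoc]
  congr 1
  apply P.hom_ext <;> simp

end mkD

end UnivStr

variable (C) in
/-- A locally cartesian closed structure: a choice of fiber products for all pairs of morphisms with
a common codomain, and for all `f : X ⟶ Z` and `g : Y ⟶ Z` a choice of a relative internal
Hom-object `hom f g` over `Z`, with an evaluation morphism `ev` over `Z` from the fiber product of
`hom f g` and `X` to `Y` such that every morphism over `Z` from the fiber product of `W` and `X` to
`Y` is obtained from `ev` through a unique morphism `W ⟶ hom f g` over `Z`. -/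
structure LCCStr where
  fp : ∀ {X Y Z : C}, (X ⟶ Z) → (Y ⟶ Z) → C
  fst : ∀ {X Y Z : C} (f : X ⟶ Z) (g : Y ⟶ Z), fp f g ⟶ X
  snd : ∀ {X Y Z : C} (f : X ⟶ Z) (g : Y ⟶ Z), fp f g ⟶ Y
  isPullback : ∀ {X Y Z : C} (f : X ⟶ Z) (g : Y ⟶ Z), IsPullback (fst f g) (snd f g) f g
  hom : ∀ {X Y Z : C}, (X ⟶ Z) → (Y ⟶ Z) → C
  homPr : ∀ {X Y Z : C} (f : X ⟶ Z) (g : Y ⟶ Z), hom f g ⟶ Z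
  ev : ∀ {X Y Z : C} (f : X ⟶ Z) (g : Y ⟶ Z), fp (homPr f g) f ⟶ Y
  ev_comp : ∀ {X Y Z : C} (f : X ⟶ Z) (g : Y ⟶ Z),
    ev f g ≫ g = fst (homPr f g) f ≫ homPr f g
  existsUnique : ∀ {X Y Z : C} (f : X ⟶ Z) (g : Y ⟶ Z) {W : C} (h : W ⟶ Z) (a : fp h f ⟶ Y),
    a ≫ g = fst h f ≫ h → ∃! b : W ⟶ hom f g, ∃ hb : b ≫ homPr f g = h,
      (isPullback (homPr f g) f).lift (fst h f ≫ b) (snd h f)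
        (by rw [Category.assoc, hb, (isPullback h f).w]) ≫ ev f g = a

namespace LCCStr

variable (L : LCCStr C)

section General

variable {X Y Z : C} (f : X ⟶ Z) (g : Y ⟶ Z)

lemma w : L.fst f g ≫ f = L.snd f g ≫ g := (L.isPullback f g).w

variable {f g} in
/-- The morphism to a chosen fiber product given by a pair of morphisms. -/
noncomputable def lift {W : C} (a : W ⟶ X) (b : W ⟶ Y) (h : a ≫ f = b ≫ g) : W ⟶ L.fp f g :=
  (L.isPullback f g).lift a b h

variable {f g} in
@[simp]
lemma lift_fst {W : C} (a : W ⟶ X) (b : W ⟶ Y) (h : a ≫ f = b ≫ g) :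
    L.lift a b h ≫ L.fst f g = a := by simp [lift]

variable {f g} in
@[simp]
lemma lift_fst_assoc {W : C} (a : W ⟶ X) (b : W ⟶ Y) (h : a ≫ f = b ≫ g) {K : C} (k : X ⟶ K) :
    L.lift a b h ≫ L.fst f g ≫ k = a ≫ k := by
  simpa only [Category.assoc, Category.id_comp] using congrArg (fun t => t ≫ k) (L.lift_fst a b h)

variable {f g} in
@[simp]
lemma lift_snd {W : C} (a : W ⟶ X) (b : W ⟶ Y) (h : a ≫ f = b ≫ g) :
    L.lift a b h ≫ L.snd f g = b := by simp [lift]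

variable {f g} in
@[simp]
lemma lift_snd_assoc {W : C} (a : W ⟶ X) (b : W ⟶ Y) (h : a ≫ f = b ≫ g) {K : C} (k : Y ⟶ K) :
    L.lift a b h ≫ L.snd f g ≫ k = b ≫ k := by
  simpa only [Category.assoc, Category.id_comp] using congrArg (fun t => t ≫ k) (L.lift_snd a b h)

variable {f g} in
lemma hom_ext {W : C} {a b : W ⟶ L.fp f g} (h1 : a ≫ L.fst f g = b ≫ L.fst f g)
    (h2 : a ≫ L.snd f g = b ≫ L.snd f g) : a = b :=
  (L.isPullback f g).hom_ext h1 h2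

variable {W : C} (h : W ⟶ Z) (a : L.fp h f ⟶ Y) (ha : a ≫ g = L.fst h f ≫ h)

/-- The morphism adjoint to `a`. -/
noncomputable def curry : W ⟶ L.hom f g := (L.existsUnique f g h a ha).choose

@[simp]
lemma curry_pr : L.curry f g h a ha ≫ L.homPr f g = h :=
  (L.existsUnique f g h a ha).choose_spec.1.choose

lemma curry_ev : L.lift (L.fst h f ≫ L.curry f g h a ha) (L.snd h f)
    (by rw [Category.assoc, curry_pr, L.w]) ≫ L.ev f g = a :=
  (L.existsUnique f g h a ha).choose_spec.1.choose_spec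

variable {f g} in
lemma hom_hom_ext {b b' : W ⟶ L.hom f g} (hb : b ≫ L.homPr f g = h) (hb' : b' ≫ L.homPr f g = h)
    (hh : L.lift (L.fst h f ≫ b) (L.snd h f) (by rw [Category.assoc, hb, L.w]) ≫ L.ev f g =
      L.lift (L.fst h f ≫ b') (L.snd h f) (by rw [Category.assoc, hb', L.w]) ≫ L.ev f g) :
    b = b' := by
  refine (L.existsUnique f g h _ ?_).unique ⟨hb, rfl⟩ ⟨hb', hh.symm⟩
  have := L.lift_fst_assoc (L.fst h f ≫ b) (L.snd h f)
    (by rw [Category.assoc, hb, L.w]) (L.homPr f g)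
  refine (Category.assoc _ _ _).trans
    ((congrArg (fun t => _ ≫ t) (L.ev_comp f g)).trans (this.trans ?_))
  rw [Category.assoc, hb]

end General

/-- The action of the relative internal Hom-object on a morphism `k` over `Z` in the second
argument. -/
noncomputable def homMapRight {X Y Y' Z : C} (f : X ⟶ Z) {g : Y ⟶ Z} {g' : Y' ⟶ Z} (k : Y ⟶ Y')
    (hk : k ≫ g' = g) : L.hom f g ⟶ L.hom f g' :=
  L.curry f g' (L.homPr f g) (L.ev f g ≫ k) (by rw [Category.assoc, hk, L.ev_comp])

/-- The action of the relative internal Hom-object on a morphism `k` over `Z` in the first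
argument. -/
noncomputable def homMapLeft {X X' Y Z : C} {f : X ⟶ Z} {f' : X' ⟶ Z} (k : X' ⟶ X)
    (hk : k ≫ f = f') (g : Y ⟶ Z) : L.hom f g ⟶ L.hom f' g :=
  L.curry f' g (L.homPr f g)
    (L.lift (L.fst (L.homPr f g) f') (L.snd (L.homPr f g) f' ≫ k)
      (by rw [Category.assoc, hk, L.w]) ≫ L.ev f g)
    (by rw [Category.assoc, L.ev_comp, L.lift_fst_assoc])

section I

variable {pt : C} (hpt : IsTerminal pt)

/-- The product of two objects, as a fiber product over the final object. -/
abbrev prod (X Y : C) : C := L.fp (hpt.from X) (hpt.from Y)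

/-- The first projection of a product. -/
abbrev prodFst (X Y : C) : L.prod hpt X Y ⟶ X := L.fst (hpt.from X) (hpt.from Y)

/-- The second projection of a product. -/
abbrev prodSnd (X Y : C) : L.prod hpt X Y ⟶ Y := L.snd (hpt.from X) (hpt.from Y)

/-- The morphism `Id_X × k`. -/
noncomputable abbrev prodMap (X : C) {Y Y' : C} (k : Y ⟶ Y') :
    L.prod hpt X Y ⟶ L.prod hpt X Y' :=
  L.lift (L.prodFst hpt X Y) (L.prodSnd hpt X Y ≫ k) (hpt.hom_ext _ _)

variable {U Ut : C} (p : Ut ⟶ U)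

/-- `I_p(V)`, the relative internal Hom-object over `U` from `(Ut, p)` to `(U × V, pr₁)`. -/
abbrev I (V : C) : C := L.hom p (L.prodFst hpt U V)

/-- The projection `I_p(V) ⟶ U`. -/
abbrev prI (V : C) : L.I hpt p V ⟶ U := L.homPr p (L.prodFst hpt U V)

/-- The action of `I_p` on morphisms. -/
noncomputable def Imap {V V' : C} (k : V ⟶ V') : L.I hpt p V ⟶ L.I hpt p V' :=
  L.homMapRight p (L.prodMap hpt U k) (by simp)

variable {p} in
/-- The morphism `I^g(V) : I_p(V) ⟶ I_{p'}(V)` for `g : Ut' ⟶ Ut` over `U`. -/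
noncomputable def Ipre {Ut' : C} {p' : Ut' ⟶ U} (g : Ut' ⟶ Ut) (hg : g ≫ p = p') (V : C) :
    L.I hpt p V ⟶ L.I hpt p' V :=
  L.homMapLeft g hg (L.prodFst hpt U V)

variable {p} (P : UnivStr p)

/-- The morphism `st_p(V) : (I_p(V); prI_p(V)) ⟶ V`. -/
noncomputable def st (V : C) : P.ext (L.prI hpt p V) ⟶ V :=
  L.lift (P.pr _) (P.Q _) (P.w _).symm ≫ L.ev p (L.prodFst hpt U V) ≫ L.prodSnd hpt U V

/-- The map `η^!_{p, X, V} : Hom(X, I_p(V)) → D_p(X, V)`. -/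
noncomputable def etaInv {X V : C} (g : X ⟶ L.I hpt p V) : P.D X V :=
  P.Dpre g ⟨L.prI hpt p V, L.st hpt P V⟩

lemma etaInv_snd {X V : C} (g : X ⟶ L.I hpt p V) :
    (L.etaInv hpt P g).2 = L.lift (P.pr _ ≫ g) (P.Q _) (by rw [Category.assoc, P.w]; rfl) ≫
      L.ev p (L.prodFst hpt U V) ≫ L.prodSnd hpt U V := by
  simp only [etaInv, st, ← Category.assoc]
  congr 2
  apply L.hom_ext <;> simp

lemma etaInv_bijective (X V : C) :
    Function.Bijective (L.etaInv hpt P : (X ⟶ L.I hpt p V) → P.D X V) := by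
  constructor
  · intro g g' hgg
    have h1 : g ≫ L.prI hpt p V = g' ≫ L.prI hpt p V := congrArg Sigma.fst hgg
    have h2 := P.D_snd_eq hgg
    rw [etaInv_snd, etaInv_snd] at h2
    apply L.hom_hom_ext _ rfl h1.symm
    apply L.hom_ext
    · have e0 : ∀ (b : X ⟶ L.I hpt p V) (hb : b ≫ L.prI hpt p V = g ≫ L.prI hpt p V),
          (L.lift (L.fst (g ≫ L.prI hpt p V) p ≫ b) (L.snd (g ≫ L.prI hpt p V) p)
            (by rw [Category.assoc, hb, L.w]) ≫ L.ev p (L.prodFst hpt U V)) ≫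
            L.prodFst hpt U V = L.fst (g ≫ L.prI hpt p V) p ≫ g ≫ L.prI hpt p V := by
        intro b hb
        refine (Category.assoc _ _ _).trans
          ((congrArg (fun t => _ ≫ t) (L.ev_comp p (L.prodFst hpt U V))).trans ?_)
        refine (L.lift_fst_assoc _ _ _ _).trans ?_
        rw [Category.assoc, hb]
      exact (e0 g rfl).trans (e0 g' h1.symm).symm
    · have e : ∀ (F : X ⟶ U) (hF : g ≫ L.prI hpt p V = F) (b : X ⟶ L.I hpt p V)
          (hb : b ≫ L.prI hpt p V = F),
          L.lift (L.fst F p ≫ b) (L.snd F p) (by rw [Category.assoc, hb, L.w]) =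
          P.pair (F := F) (L.fst F p) (L.snd F p) (L.w _ _) ≫
            L.lift (P.pr F ≫ b) (P.Q F) (by rw [Category.assoc, hb, P.w]) := by
        intro F hF b hb
        apply L.hom_ext <;> simp
      have e2 : P.trans h1 ≫ L.lift (P.pr _ ≫ g') (P.Q (g' ≫ L.prI hpt p V))
          (by rw [Category.assoc, P.w]) =
          L.lift (P.pr _ ≫ g') (P.Q (g ≫ L.prI hpt p V))
          (by rw [Category.assoc, ← h1, P.w]) := by
        apply L.hom_ext <;> simp
      rw [e _ rfl g rfl, e _ rfl g' h1.symm]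
      simp only [Category.assoc]
      have h3 := (Category.assoc (P.trans h1) _ _).symm.trans
        (congrArg (fun t => t ≫ L.ev p (L.prodFst hpt U V) ≫ L.prodSnd hpt U V) e2)
      exact congrArg (fun t => _ ≫ t) (h2.trans h3)
  · rintro ⟨F, a⟩
    let c : L.fp F p ⟶ P.ext F := P.pair (L.fst F p) (L.snd F p) (L.w _ _)
    let a' : L.fp F p ⟶ L.prod hpt U V := L.lift (L.fst F p ≫ F) (c ≫ a) (hpt.hom_ext _ _)
    have ha' : a' ≫ L.prodFst hpt U V = L.fst F p ≫ F := by simp [a']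
    refine ⟨L.curry p (L.prodFst hpt U V) F a' ha', ?_⟩
    have h1 : L.curry p (L.prodFst hpt U V) F a' ha' ≫ L.prI hpt p V = F := L.curry_pr ..
    refine P.D_ext h1 ?_
    have h2 := L.curry_ev p (L.prodFst hpt U V) F a' ha'
    rw [etaInv_snd]
    have h3 : L.lift (P.pr _ ≫ L.curry p (L.prodFst hpt U V) F a' ha') (P.Q _)
        (by rw [Category.assoc, P.w]) =
        P.trans h1 ≫ L.lift (P.pr F) (P.Q F) (P.w F).symm ≫
          L.lift (L.fst F p ≫ L.curry p (L.prodFst hpt U V) F a' ha') (L.snd F p)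
          (by rw [Category.assoc, h1, L.w]) := by
      apply L.hom_ext <;> simp
    have h4 : L.lift (P.pr F) (P.Q F) (P.w F).symm ≫ c = 𝟙 _ := by
      apply P.hom_ext <;> simp [c]
    refine (congrArg (fun t => t ≫ L.ev p (L.prodFst hpt U V) ≫ L.prodSnd hpt U V) h3).trans ?_
    simp only [Category.assoc]
    have h5 := congrArg (fun t => t ≫ L.prodSnd hpt U V) h2
    simp only [Category.assoc] at h5
    rw [h5]
    simp only [a', lift_snd]
    rw [reassoc_of% h4]
    rfl

/-- The bijection `η_{p, X, V} : D_p(X, V) → Hom(X, I_p(V))`, the inverse of `η^!_{p, X, V}`. -/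
noncomputable def eta (X V : C) : P.D X V ≃ (X ⟶ L.I hpt p V) :=
  (Equiv.ofBijective _ (L.etaInv_bijective hpt P X V)).symm

lemma eta_etaInv {X V : C} (g : X ⟶ L.I hpt p V) :
    L.eta hpt P X V (L.etaInv hpt P g) = g :=
  (Equiv.ofBijective _ (L.etaInv_bijective hpt P X V)).symm_apply_apply g

lemma etaInv_eta {X V : C} (d : P.D X V) :
    L.etaInv hpt P (L.eta hpt P X V d) = d :=
  (Equiv.ofBijective _ (L.etaInv_bijective hpt P X V)).apply_symm_apply d

lemma etaInv_comp {X' X V : C} (f : X' ⟶ X) (g : X ⟶ L.I hpt p V) :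
    L.etaInv hpt P (f ≫ g) = P.Dpre f (L.etaInv hpt P g) := by
  refine P.D_ext (by simp [etaInv]) ?_
  simp only [etaInv, ← Category.assoc]
  congr 1
  apply P.hom_ext
  · simp only [Category.assoc, UnivStr.Qm_pr, UnivStr.Qm_pr_assoc]
    exact (P.trans_pr_assoc _ _).symm
  · simp only [Category.assoc, UnivStr.Qm_Q]
    exact (P.trans_Q _).symm

lemma etaInv_Imap {X V V' : C} (k : V ⟶ V') (g : X ⟶ L.I hpt p V) :
    L.etaInv hpt P (g ≫ L.Imap hpt p k) = P.Dmap k (L.etaInv hpt P g) := by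
  have h0 : L.Imap hpt p k ≫ L.prI hpt p V' = L.prI hpt p V :=
    L.curry_pr p (L.prodFst hpt U V') _ _ (by simp [L.ev_comp])
  have h1 : (g ≫ L.Imap hpt p k) ≫ L.prI hpt p V' = g ≫ L.prI hpt p V := by
    rw [Category.assoc, h0]
  refine P.D_ext h1 ?_
  dsimp only
  rw [etaInv_snd, etaInv_snd]
  have h2 := L.curry_ev p (L.prodFst hpt U V') (L.prI hpt p V)
    (L.ev p (L.prodFst hpt U V) ≫ L.prodMap hpt U k) (by simp [L.ev_comp])
  have h3 : L.lift (f := L.prI hpt p V') (g := p) (P.pr _ ≫ g ≫ L.Imap hpt p k) (P.Q _)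
      (by rw [P.w]; exact Category.assoc _ _ _) =
      P.trans h1 ≫ L.lift (f := L.prI hpt p V) (g := p) (P.pr _ ≫ g) (P.Q _)
        (by rw [Category.assoc, P.w]) ≫
        L.lift (L.fst (L.prI hpt p V) p ≫ L.Imap hpt p k) (L.snd _ _)
          (by rw [Category.assoc, h0, L.w]) := by
    apply L.hom_ext <;> simp
  refine (congrArg (fun t => t ≫ L.ev p (L.prodFst hpt U V') ≫ L.prodSnd hpt U V') h3).trans ?_
  have h5 := congrArg (fun t => t ≫ L.prodSnd hpt U V') h2
  simp only [Category.assoc, lift_snd] at h5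
  simp only [Category.assoc]
  exact congrArg (fun t => P.trans h1 ≫ _ ≫ t) h5

lemma etaInv_Ipre {Ut' : C} {p' : Ut' ⟶ U} (P' : UnivStr p') (k : Ut' ⟶ Ut) (hk : k ≫ p = p')
    {X V : C} (g : X ⟶ L.I hpt p V) :
    L.etaInv hpt P' (g ≫ L.Ipre hpt k hk V) = P.Dstar P' k hk (L.etaInv hpt P g) := by
  have h0 : L.Ipre hpt k hk V ≫ L.prI hpt p' V = L.prI hpt p V :=
    L.curry_pr p' (L.prodFst hpt U V) _ _
      (by rw [Category.assoc, L.ev_comp, L.lift_fst_assoc])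
  have h1 : (g ≫ L.Ipre hpt k hk V) ≫ L.prI hpt p' V = g ≫ L.prI hpt p V := by
    rw [Category.assoc, h0]
  refine P'.D_ext h1 ?_
  dsimp only
  rw [etaInv_snd, etaInv_snd]
  have h2 := L.curry_ev p' (L.prodFst hpt U V) (L.prI hpt p V)
    (L.lift (L.fst (L.prI hpt p V) p') (L.snd (L.prI hpt p V) p' ≫ k)
      (by rw [Category.assoc, hk, L.w]) ≫ L.ev p (L.prodFst hpt U V))
    (by rw [Category.assoc, L.ev_comp, L.lift_fst_assoc])
  have h3 : L.lift (f := L.prI hpt p' V) (g := p') (P'.pr _ ≫ g ≫ L.Ipre hpt k hk V) (P'.Q _)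
      (by rw [P'.w]; exact Category.assoc _ _ _) =
      P'.trans h1 ≫ L.lift (f := L.prI hpt p V) (g := p') (P'.pr _ ≫ g) (P'.Q _)
        (by rw [Category.assoc, P'.w]) ≫
        L.lift (L.fst (L.prI hpt p V) p' ≫ L.Ipre hpt k hk V) (L.snd _ _)
          (by rw [Category.assoc, h0, L.w]) := by
    apply L.hom_ext <;> simp
  refine (congrArg (fun t => t ≫ L.ev p' (L.prodFst hpt U V) ≫ L.prodSnd hpt U V) h3).trans ?_
  have h5 := congrArg (fun t => t ≫ L.prodSnd hpt U V) h2
  simp only [Category.assoc] at h5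
  simp only [Category.assoc]
  refine (congrArg (fun t => P'.trans h1 ≫ _ ≫ t) h5).trans ?_
  simp only [← Category.assoc]
  congr 2
  simp only [Category.assoc]
  congr 1
  apply L.hom_ext <;> simp [UnivStr.star, etaInv]

lemma eta_Dpre {X' X V : C} (f : X' ⟶ X) (d : P.D X V) :
    L.eta hpt P X' V (P.Dpre f d) = f ≫ L.eta hpt P X V d := by
  rw [← L.eta_etaInv hpt P (f ≫ _), etaInv_comp, etaInv_eta]

lemma eta_Dmap {X V V' : C} (k : V ⟶ V') (d : P.D X V) :
    L.eta hpt P X V' (P.Dmap k d) = L.eta hpt P X V d ≫ L.Imap hpt p k := by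
  rw [← L.eta_etaInv hpt P (_ ≫ L.Imap hpt p k), etaInv_Imap, etaInv_eta]

lemma eta_Dstar {Ut' : C} {p' : Ut' ⟶ U} (P' : UnivStr p') (k : Ut' ⟶ Ut) (hk : k ≫ p = p')
    {X V : C} (d : P.D X V) :
    L.eta hpt P' X V (P.Dstar P' k hk d) = L.eta hpt P X V d ≫ L.Ipre hpt k hk V := by
  rw [← L.eta_etaInv hpt P' (_ ≫ L.Ipre hpt k hk V), L.etaInv_Ipre hpt P, etaInv_eta]

end I

end LCCStr

/-! ### J-structures on universes -/

namespace UnivStr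

variable {U Ut : C} {p : Ut ⟶ U} (P : UnivStr p)

/-- A J0-structure on a universe: a morphism `(Ut; p) ⟶ U`. -/
abbrev J0 : Type v := P.ext p ⟶ U

/-- The diagonal `Ut ⟶ (Ut; p)`. -/
noncomputable def Delta : Ut ⟶ P.ext p := P.pair (𝟙 Ut) (𝟙 Ut) rfl

@[simp]
lemma Delta_pr : P.Delta ≫ P.pr p = 𝟙 _ := P.pair_pr _ _ _

@[simp]
lemma Delta_pr_assoc {K : C} (k : Ut ⟶ K) :
    P.Delta ≫ P.pr p ≫ k = k := by
  simpa only [Category.assoc, Category.id_comp] using congrArg (fun t => t ≫ k) (P.Delta_pr)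

@[simp]
lemma Delta_Q : P.Delta ≫ P.Q p = 𝟙 _ := P.pair_Q _ _ _

section

variable {P} (Eq : P.J0)

/-- The projection `pE : (Ut; p, Eq) ⟶ U`. -/
abbrev pE : P.ext Eq ⟶ U := P.pr Eq ≫ P.pr p ≫ p

/-- The universe structure on `pE`, given by vertical concatenation of three canonical squares
of `p`. -/
@[simps]
noncomputable def E : UnivStr (pE Eq) where
  ext F := P.ext (P.Qm (P.Q F) p ≫ Eq)
  pr F := P.pr (P.Qm (P.Q F) p ≫ Eq) ≫ P.pr (P.Q F ≫ p) ≫ P.pr F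
  Q F := P.Qm (P.Qm (P.Q F) p) Eq
  isPullback F := (P.isPullback_Qm (P.Qm (P.Q F) p) Eq).paste_vert
    ((P.isPullback_Qm (P.Q F) p).paste_vert (P.isPullback F))

/-- A J1-structure on a universe over a J0-structure. -/
structure J1 where
  Om : Ut ⟶ Ut
  comm : Om ≫ p = P.Delta ≫ Eq

variable {Eq} (Om : J1 Eq)

/-- The morphism `ω : Ut ⟶ (Ut; p, Eq)`. -/
noncomputable def J1.om : Ut ⟶ P.ext Eq := P.pair P.Delta Om.Om Om.comm.symm

@[simp]
lemma J1.om_pr : Om.om ≫ P.pr Eq = P.Delta := P.pair_pr _ _ _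

@[simp]
lemma J1.om_pr_assoc {K : C} (k : P.ext p ⟶ K) :
    Om.om ≫ P.pr Eq ≫ k = P.Delta ≫ k := by
  simpa only [Category.assoc, Category.id_comp] using congrArg (fun t => t ≫ k) (Om.om_pr)

@[simp]
lemma J1.om_Q : Om.om ≫ P.Q Eq = Om.Om := P.pair_Q _ _ _

lemma J1.om_pE : Om.om ≫ pE Eq = p := by simp [pE]

end

end UnivStr

namespace LCCStr

variable (L : LCCStr C) {pt : C} (hpt : IsTerminal pt) {U Ut : C} {p : Ut ⟶ U}

lemma Imap_Ipre (P : UnivStr p) {Ut' : C} {p' : Ut' ⟶ U} (P' : UnivStr p') (g : Ut' ⟶ Ut)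
    (hg : g ≫ p = p') {V V' : C} (k : V ⟶ V') :
    L.Imap hpt p k ≫ L.Ipre hpt g hg V' = L.Ipre hpt g hg V ≫ L.Imap hpt p' k := by
  apply (L.etaInv_bijective hpt P' _ _).1
  rw [L.etaInv_Ipre hpt P P', L.etaInv_Imap hpt P']
  have h1 := L.etaInv_Imap hpt P k (𝟙 _)
  have h2 := L.etaInv_Ipre hpt P P' g hg (𝟙 (L.I hpt p V))
  rw [Category.id_comp] at h1 h2
  rw [h1, h2]
  simp [UnivStr.Dmap, UnivStr.Dstar]

lemma Imap_comp (P : UnivStr p) {V V' V'' : C} (k : V ⟶ V') (k' : V' ⟶ V'') :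
    L.Imap hpt p (k ≫ k') = L.Imap hpt p k ≫ L.Imap hpt p k' := by
  apply (L.etaInv_bijective hpt P _ _).1
  have h1 := L.etaInv_Imap hpt P (k ≫ k') (𝟙 _)
  have h2 := L.etaInv_Imap hpt P k (𝟙 _)
  rw [Category.id_comp] at h1 h2
  rw [h1, L.etaInv_Imap hpt P, h2]
  simp [UnivStr.Dmap]

variable {P : UnivStr p} {Eq : P.J0} (Om : UnivStr.J1 Eq)

/-- The morphism `I^ω(V)` from `I_{pE}(V)` to `I_p(V)`. -/
noncomputable abbrev Iom (V : C) : L.I hpt (UnivStr.pE Eq) V ⟶ L.I hpt p V :=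
  L.Ipre hpt Om.om Om.om_pE V

/-- The fiber product of `I_{pE}(U)` and `I_p(Ut)` over `I_p(U)`. -/
noncomputable abbrev Fp : C := L.fp (L.Iom hpt Om U) (L.Imap hpt p p)

/-- The morphism `coJ` from `I_{pE}(Ut)` to the fiber product. -/
noncomputable def coJ : L.I hpt (UnivStr.pE Eq) Ut ⟶ L.Fp hpt Om :=
  L.lift (L.Imap hpt (UnivStr.pE Eq) p) (L.Iom hpt Om Ut) (L.Imap_Ipre hpt (UnivStr.E Eq) P _ _ p)

end LCCStr

/-- A J2-structure on a universe relative to a J0-structure and a J1-structure: a section of `coJ`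
(compositions are written in the diagrammatic order). -/
structure UnivStr.J2 (L : LCCStr C) {pt : C} (hpt : IsTerminal pt) {U Ut : C} {p : Ut ⟶ U}
    {P : UnivStr p} {Eq : P.J0} (Om : UnivStr.J1 Eq) where
  Jp : L.Fp hpt Om ⟶ L.I hpt (UnivStr.pE Eq) Ut
  Jp_coJ : Jp ≫ L.coJ hpt Om = 𝟙 _

end Universes

/-! ### Universe category functors -/

section Functors

variable {C : Type u} [Category.{v} C] {C' : Type u'} [Category.{v'} C']
  {U Ut : C} {p : Ut ⟶ U} {U' Ut' : C'} {p' : Ut' ⟶ U'}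

/-- The conditions on a triple `(Φ, φ, φt)` for it to be a functor between universes (without the
condition on final objects). -/
structure IsUnivFunctor (P : UnivStr p) (P' : UnivStr p') (Φ : C ⥤ C') (φ : Φ.obj U ⟶ U')
    (φt : Φ.obj Ut ⟶ Ut') : Prop where
  isPullback : IsPullback φt (Φ.map p) p' φ
  map_isPullback : ∀ {X : C} (F : X ⟶ U),
    IsPullback (Φ.map (P.Q F)) (Φ.map (P.pr F)) (Φ.map p) (Φ.map F)

namespace IsUnivFunctor

variable {P : UnivStr p} {P' : UnivStr p'} {Φ : C ⥤ C'} {φ : Φ.obj U ⟶ U'} {φt : Φ.obj Ut ⟶ Ut'}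

section Basic

variable (h : IsUnivFunctor P P' Φ φ φt)

lemma comm (h : IsUnivFunctor P P' Φ φ φt) : φt ≫ p' = Φ.map p ≫ φ := h.isPullback.w

lemma sq (h : IsUnivFunctor P P' Φ φ φt) {X : C} (F : X ⟶ U) :
    IsPullback (Φ.map (P.Q F) ≫ φt) (Φ.map (P.pr F)) p' (Φ.map F ≫ φ) :=
  (h.map_isPullback F).paste_horiz h.isPullback

lemma map_Qm_isPullback (h : IsUnivFunctor P P' Φ φ φt) {X' X : C} (f : X' ⟶ X)
    (F : X ⟶ U) :
    IsPullback (Φ.map (P.Qm f F)) (Φ.map (P.pr (f ≫ F))) (Φ.map (P.pr F)) (Φ.map f) :=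
  IsPullback.of_right (by rw [← Φ.map_comp, ← Φ.map_comp, P.Qm_Q]; exact h.map_isPullback (f ≫ F))
    (by rw [← Φ.map_comp, P.Qm_pr, Φ.map_comp]) (h.map_isPullback F)

/-- The isomorphism `ι : (Φ(X); Φ(F) ≫ φ)' ⟶ Φ((X; F))`. -/
noncomputable def iota {X : C} (F : X ⟶ U) : P'.ext (Φ.map F ≫ φ) ⟶ Φ.obj (P.ext F) :=
  (h.sq F).lift (P'.Q _) (P'.pr _) (P'.w _)

@[simp]
lemma iota_Q {X : C} (F : X ⟶ U) : h.iota F ≫ Φ.map (P.Q F) ≫ φt = P'.Q _ := by simp [iota]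

@[simp]
lemma iota_Q_assoc {X : C} (F : X ⟶ U) {K : C'} (k : Ut' ⟶ K) :
    h.iota F ≫ Φ.map (P.Q F) ≫ φt ≫ k = P'.Q _ ≫ k := by
  simpa only [Category.assoc, Category.id_comp] using congrArg (fun t => t ≫ k) (h.iota_Q F)

@[simp]
lemma iota_pr {X : C} (F : X ⟶ U) : h.iota F ≫ Φ.map (P.pr F) = P'.pr _ := by simp [iota]

@[simp]
lemma iota_pr_assoc {X : C} (F : X ⟶ U) {K : C'} (k : Φ.obj X ⟶ K) :
    h.iota F ≫ Φ.map (P.pr F) ≫ k = P'.pr _ ≫ k := by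
  simpa only [Category.assoc, Category.id_comp] using congrArg (fun t => t ≫ k) (h.iota_pr F)

/-- The map `Φ² : D_p(X, V) → D_{p'}(Φ(X), Φ(V))`. -/
noncomputable abbrev Phi2 {X V : C} (d : P.D X V) : P'.D (Φ.obj X) (Φ.obj V) :=
  ⟨Φ.map d.1 ≫ φ, h.iota d.1 ≫ Φ.map d.2⟩

lemma Phi2_Dpre {X' X V : C} (f : X' ⟶ X) (d : P.D X V) :
    h.Phi2 (P.Dpre f d) = P'.Dpre (Φ.map f) (h.Phi2 d) := by
  refine P'.D_ext (by simp) ?_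
  simp only [Φ.map_comp, ← Category.assoc]
  congr 1
  apply (h.sq d.1).hom_ext
  · simp only [Category.assoc, h.iota_Q, UnivStr.Qm_Q, UnivStr.trans_Q]
    rw [← Φ.map_comp_assoc, P.Qm_Q, h.iota_Q]
  · simp only [Category.assoc, h.iota_pr, UnivStr.Qm_pr]
    have e : Φ.map (P.Qm f d.1) ≫ Φ.map (P.pr d.1) = Φ.map (P.pr (f ≫ d.1)) ≫ Φ.map f := by
      rw [← Φ.map_comp, P.Qm_pr, Φ.map_comp]
    rw [e, h.iota_pr_assoc]
    exact (P'.trans_pr_assoc _ _).symm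

lemma Phi2_Dmap {X V V' : C} (k : V ⟶ V') (d : P.D X V) :
    h.Phi2 (P.Dmap k d) = P'.Dmap (Φ.map k) (h.Phi2 d) := by
  simp [Phi2, UnivStr.Dmap]

variable (L : LCCStr C) (L' : LCCStr C') {pt : C} (hpt : IsTerminal pt) {pt' : C'}
  (hpt' : IsTerminal pt')

/-- The morphism `χ(V) : Φ(I_p(V)) ⟶ I_{p'}(Φ(V))`. -/
noncomputable def chi (V : C) : Φ.obj (L.I hpt p V) ⟶ L'.I hpt' p' (Φ.obj V) :=
  L'.eta hpt' P' _ _ (h.Phi2 (L.etaInv hpt P (𝟙 (L.I hpt p V))))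

lemma map_chi {X V : C} (a : X ⟶ L.I hpt p V) :
    Φ.map a ≫ h.chi L L' hpt hpt' V = L'.eta hpt' P' _ _ (h.Phi2 (L.etaInv hpt P a)) := by
  rw [chi, ← L'.eta_Dpre hpt' P', ← h.Phi2_Dpre, ← L.etaInv_comp, Category.comp_id]

lemma chi_Imap {V V' : C} (k : V ⟶ V') :
    h.chi L L' hpt hpt' V ≫ L'.Imap hpt' p' (Φ.map k) =
      Φ.map (L.Imap hpt p k) ≫ h.chi L L' hpt hpt' V' := by
  have h1 := L.etaInv_Imap hpt P k (𝟙 _)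
  rw [Category.id_comp] at h1
  rw [map_chi, h1, Phi2_Dmap, L'.eta_Dmap, chi]

end Basic

section TwoUniverses

variable {Ut₁ : C} {p₁ : Ut₁ ⟶ U} {P₁ : UnivStr p₁} {Ut₁' : C'} {p₁' : Ut₁' ⟶ U'}
  {P₁' : UnivStr p₁'} {φt₁ : Φ.obj Ut₁ ⟶ Ut₁'} (h : IsUnivFunctor P P' Φ φ φt)
  (h₁ : IsUnivFunctor P₁ P₁' Φ φ φt₁) (g : Ut₁ ⟶ Ut) (hg : g ≫ p = p₁) (g' : Ut₁' ⟶ Ut')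
  (hg' : g' ≫ p' = p₁')

lemma Phi2_Dstar (hgg : φt₁ ≫ g' = Φ.map g ≫ φt) {X V : C} (d : P.D X V) :
    h₁.Phi2 (P.Dstar P₁ g hg d) = P'.Dstar P₁' g' hg' (h.Phi2 d) := by
  refine P₁'.D_ext rfl ?_
  rw [UnivStr.trans_refl, Category.id_comp]
  simp only [Φ.map_comp, ← Category.assoc]
  congr 1
  apply (h.sq d.1).hom_ext
  · have e1 : P.star P₁ g hg d.1 ≫ P.Q d.1 = P₁.Q d.1 ≫ g := P.pair_Q _ _ _
    have e2 : P'.star P₁' g' hg' (Φ.map d.1 ≫ φ) ≫ P'.Q _ = P₁'.Q _ ≫ g' := P'.pair_Q _ _ _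
    simp only [Category.assoc, h.iota_Q]
    rw [e2, ← Φ.map_comp_assoc, e1, Φ.map_comp, Category.assoc, ← hgg, ← h₁.iota_Q d.1]
    simp
  · have e1 : P.star P₁ g hg d.1 ≫ P.pr d.1 = P₁.pr d.1 := P.pair_pr _ _ _
    have e2 : P'.star P₁' g' hg' (Φ.map d.1 ≫ φ) ≫ P'.pr _ = P₁'.pr _ := P'.pair_pr _ _ _
    simp only [Category.assoc, h.iota_pr]
    rw [e2, ← Φ.map_comp, e1, h₁.iota_pr]

lemma chi_Ipre (hgg : φt₁ ≫ g' = Φ.map g ≫ φt) (L : LCCStr C) (L' : LCCStr C') {pt : C} (hpt : IsTerminal pt) {pt' : C'}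
    (hpt' : IsTerminal pt') (V : C) :
    h.chi L L' hpt hpt' V ≫ L'.Ipre hpt' g' hg' (Φ.obj V) =
      Φ.map (L.Ipre hpt g hg V) ≫ h₁.chi L L' hpt hpt' V := by
  have h1 := L.etaInv_Ipre hpt P P₁ g hg (𝟙 (L.I hpt p V))
  rw [Category.id_comp] at h1
  rw [map_chi, h1, Phi2_Dstar h h₁ g hg g' hg' hgg, L'.eta_Dstar hpt' P' P₁', chi]

end TwoUniverses

section J

variable (h : IsUnivFunctor P P' Φ φ φt)

/-- The morphism `Φ((Ut; p)) ⟶ (Ut'; p')` induced by `φt`. -/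
noncomputable def PhiUp : Φ.obj (P.ext p) ⟶ P'.ext p' :=
  P'.pair (Φ.map (P.pr p) ≫ φt) (Φ.map (P.Q p) ≫ φt) (by
    simp only [Category.assoc, h.comm]
    rw [← Φ.map_comp_assoc, ← Φ.map_comp_assoc, P.w])

lemma PhiUp_pr : h.PhiUp ≫ P'.pr p' = Φ.map (P.pr p) ≫ φt := P'.pair_pr _ _ _

lemma PhiUp_Q : h.PhiUp ≫ P'.Q p' = Φ.map (P.Q p) ≫ φt := P'.pair_Q _ _ _

lemma PhiUp_isPullback : IsPullback h.PhiUp (Φ.map (P.pr p)) (P'.pr p') φt := by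
  refine IsPullback.of_right (h₁₂ := P'.Q p') (h₂₂ := p') (v₁₃ := p') ?_ h.PhiUp_pr
    (P'.isPullback p')
  rw [h.PhiUp_Q, h.comm]
  exact h.sq p

/-- Compatibility of a functor of universes with J0-structures. -/
def CompatJ0 (Eq : P.J0) (Eq' : P'.J0) : Prop := Φ.map Eq ≫ φ = h.PhiUp ≫ Eq'

/-- Compatibility of a functor of universes with J1-structures. -/
def CompatJ1 (_ : IsUnivFunctor P P' Φ φ φt) {Eq : P.J0} {Eq' : P'.J0}
    (Om : UnivStr.J1 Eq) (Om' : UnivStr.J1 Eq') : Prop :=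
  Φ.map Om.Om ≫ φt = φt ≫ Om'.Om

section E

variable {h} {Eq : P.J0} {Eq' : P'.J0} (h0 : h.CompatJ0 Eq Eq')

/-- The morphism `φt_E : Φ((Ut; p, Eq)) ⟶ (Ut'; p', Eq')`. -/
noncomputable def phitE : Φ.obj (P.ext Eq) ⟶ P'.ext Eq' :=
  P'.pair (Φ.map (P.pr Eq) ≫ h.PhiUp) (Φ.map (P.Q Eq) ≫ φt) (by
    simp only [Category.assoc, h.comm]
    rw [← Φ.map_comp_assoc, P.w, Φ.map_comp_assoc, ← h0])

lemma phitE_pr : phitE h0 ≫ P'.pr Eq' = Φ.map (P.pr Eq) ≫ h.PhiUp := P'.pair_pr _ _ _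

lemma phitE_Q : phitE h0 ≫ P'.Q Eq' = Φ.map (P.Q Eq) ≫ φt := P'.pair_Q _ _ _

lemma phitE_isPullback : IsPullback (phitE h0) (Φ.map (P.pr Eq)) (P'.pr Eq') h.PhiUp := by
  refine IsPullback.of_right (h₁₂ := P'.Q Eq') (h₂₂ := Eq') (v₁₃ := p') ?_ (phitE_pr h0)
    (P'.isPullback Eq')
  rw [phitE_Q, ← h0]
  exact h.sq Eq

/-- The triple `(Φ, φ, φt_E)` is a functor between the universes `pE` and `pE'`. -/
lemma isUnivFunctorE : IsUnivFunctor (UnivStr.E Eq) (UnivStr.E Eq') Φ φ (phitE h0) where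
  isPullback := by
    have := (phitE_isPullback h0).paste_vert (h.PhiUp_isPullback.paste_vert h.isPullback)
    simpa only [← Φ.map_comp] using this
  map_isPullback F := by
    have := (h.map_Qm_isPullback (P.Qm (P.Q F) p) Eq).paste_vert
      ((h.map_Qm_isPullback (P.Q F) p).paste_vert (h.map_isPullback F))
    simp only [← Φ.map_comp] at this
    exact this

variable {Om : UnivStr.J1 Eq} {Om' : UnivStr.J1 Eq'}

lemma phit_om (h1 : h.CompatJ1 Om Om') : φt ≫ Om'.om = Φ.map Om.om ≫ phitE h0 := by
  apply P'.hom_ext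
  · apply P'.hom_ext
    · simp only [Category.assoc, phitE_pr, h.PhiUp_pr, UnivStr.J1.om_pr, UnivStr.Delta_pr]
      rw [← Φ.map_comp_assoc, ← Φ.map_comp_assoc]
      simp
    · simp only [Category.assoc, phitE_pr, h.PhiUp_Q, UnivStr.J1.om_pr, UnivStr.Delta_Q]
      rw [← Φ.map_comp_assoc, ← Φ.map_comp_assoc]
      simp
  · simp only [Category.assoc, phitE_Q, UnivStr.J1.om_Q]
    rw [← Φ.map_comp_assoc, Om.om_Q, ← h1]

end E

section R

variable (L : LCCStr C) (L' : LCCStr C') {pt : C} (hpt : IsTerminal pt) {pt' : C'}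
  (hpt' : IsTerminal pt')

/-- The morphism `ξ : Φ(I_p(U)) ⟶ I_{p'}(U')`. -/
noncomputable def xi : Φ.obj (L.I hpt p U) ⟶ L'.I hpt' p' U' :=
  h.chi L L' hpt hpt' U ≫ L'.Imap hpt' p' φ

/-- The morphism `Φ(I_p(Ut)) ⟶ I_{p'}(Ut')`. -/
noncomputable def xit : Φ.obj (L.I hpt p Ut) ⟶ L'.I hpt' p' Ut' :=
  h.chi L L' hpt hpt' Ut ≫ L'.Imap hpt' p' φt

lemma xit_Imap : h.xit L L' hpt hpt' ≫ L'.Imap hpt' p' p' =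
    Φ.map (L.Imap hpt p p) ≫ h.xi L L' hpt hpt' := by
  rw [xi, xit, Category.assoc, ← L'.Imap_comp hpt' P', h.comm, L'.Imap_comp hpt' P',
    ← Category.assoc, h.chi_Imap, Category.assoc]

variable {h} {Eq : P.J0} {Eq' : P'.J0} (h0 : h.CompatJ0 Eq Eq')

/-- The morphism `ζ : Φ(I_{pE}(U)) ⟶ I_{pE'}(U')`. -/
noncomputable def zeta :
    Φ.obj (L.I hpt (UnivStr.pE Eq) U) ⟶ L'.I hpt' (UnivStr.pE Eq') U' :=
  (isUnivFunctorE h0).chi L L' hpt hpt' U ≫ L'.Imap hpt' (UnivStr.pE Eq') φ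

/-- The morphism `Φ(I_{pE}(Ut)) ⟶ I_{pE'}(Ut')`. -/
noncomputable def zetat :
    Φ.obj (L.I hpt (UnivStr.pE Eq) Ut) ⟶ L'.I hpt' (UnivStr.pE Eq') Ut' :=
  (isUnivFunctorE h0).chi L L' hpt hpt' Ut ≫ L'.Imap hpt' (UnivStr.pE Eq') φt

variable {Om : UnivStr.J1 Eq} {Om' : UnivStr.J1 Eq'} (h1 : h.CompatJ1 Om Om')

lemma zeta_Iom (h1 : h.CompatJ1 Om Om') : zeta L L' hpt hpt' h0 ≫ L'.Iom hpt' Om' U' =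
    Φ.map (L.Iom hpt Om U) ≫ h.xi L L' hpt hpt' := by
  have e := chi_Ipre (isUnivFunctorE h0) h Om.om Om.om_pE Om'.om Om'.om_pE (phit_om h0 h1)
    L L' hpt hpt' U
  have e2 := L'.Imap_Ipre hpt' (UnivStr.E Eq') P' Om'.om Om'.om_pE φ
  rw [zeta, xi, Category.assoc]
  refine (congrArg (fun t => _ ≫ t) e2).trans ?_
  rw [← Category.assoc, e, Category.assoc]

/-- The morphism `R` between the fiber products on which the J2-structures are defined. -/
noncomputable def R : Φ.obj (L.Fp hpt Om) ⟶ L'.Fp hpt' Om' :=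
  L'.lift (Φ.map (L.fst _ _) ≫ zeta L L' hpt hpt' h0) (Φ.map (L.snd _ _) ≫ h.xit L L' hpt hpt')
    (by
      rw [Category.assoc, zeta_Iom L L' hpt hpt' h0 h1, Category.assoc, h.xit_Imap,
        ← Φ.map_comp_assoc, ← Φ.map_comp_assoc, L.w])

/-- Compatibility of a functor of universes, which is compatible with given J0- and J1-structures,
with J2-structures. -/
def CompatJ2 (Jp : UnivStr.J2 L hpt Om) (Jp' : UnivStr.J2 L' hpt' Om') : Prop :=
  Φ.map Jp.Jp ≫ zetat L L' hpt hpt' h0 = R L L' hpt hpt' h0 h1 ≫ Jp'.Jp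

end R

end J

end IsUnivFunctor

end Functors

/-! ### The C-system of a universe category -/

/-- A universe category structure on `C`: a universe and a choice of a final object. -/
structure UniverseCategory (C : Type u) [Category.{v} C] where
  U : C
  Ut : C
  p : Ut ⟶ U
  str : UnivStr p
  pt : C
  isTerminal : IsTerminal pt

namespace UniverseCategory

section Basic

variable {C : Type u} [Category.{v} C] (𝒰 : UniverseCategory C)

/-- The set of objects of length `n` of the C-system of a universe category, together with the map
`int`, by recursion: there is one object of length `0`, with `int` equal to `pt`, and objects of
length `n + 1` are pairs of `Γ` of length `n` and `F : int Γ ⟶ U`, with `int` equal to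
`(int Γ; F)`. -/
def ctx : ℕ → Σ A : Type v, (A → C)
  | 0 => ⟨PUnit, fun _ => 𝒰.pt⟩
  | n + 1 => ⟨Σ Γ : (ctx n).1, ((ctx n).2 Γ ⟶ 𝒰.U), fun x => 𝒰.str.ext x.2⟩

/-- The objects of the C-system of a universe category. -/
def CC : Type v := Σ n : ℕ, (𝒰.ctx n).1

instance : CtxLength 𝒰.CC where
  len Γ := Γ.1
  ft
    | ⟨0, x⟩ => ⟨0, x⟩
    | ⟨n + 1, x⟩ => ⟨n, x.1⟩

/-- The underlying object of `C`. -/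
def intObj (Γ : 𝒰.CC) : C := (𝒰.ctx Γ.1).2 Γ.2

instance : Category.{v} 𝒰.CC where
  Hom Γ Δ := 𝒰.intObj Γ ⟶ 𝒰.intObj Δ
  id Γ := 𝟙 (𝒰.intObj Γ)
  comp f g := CategoryStruct.comp (obj := C) f g

/-- The functor `int`, the identity on morphisms. -/
def int : 𝒰.CC ⥤ C where
  obj := 𝒰.intObj
  map f := f

variable {𝒰}

/-- A morphism of the C-system from a morphism of `C`. -/
def homMk {Γ Δ : 𝒰.CC} (f : 𝒰.int.obj Γ ⟶ 𝒰.int.obj Δ) : Γ ⟶ Δ := f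

@[simp] lemma int_homMk {Γ Δ : 𝒰.CC} (f : 𝒰.int.obj Γ ⟶ 𝒰.int.obj Δ) :
    𝒰.int.map (homMk f) = f := rfl

lemma int_inj {Γ Δ : 𝒰.CC} {f g : Γ ⟶ Δ} (h : 𝒰.int.map f = 𝒰.int.map g) : f = g := h

instance : 𝒰.int.Faithful where
  map_injective h := h

instance : 𝒰.int.Full where
  map_surjective f := ⟨f, rfl⟩

/-- The object `(Γ, F)`. -/
def ext (Γ : 𝒰.CC) (F : 𝒰.int.obj Γ ⟶ 𝒰.U) : Ob1 Γ where
  obj := ⟨Γ.1 + 1, ⟨Γ.2, F⟩⟩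
  len_pos := Nat.succ_pos _
  ft_eq := rfl

/-- The bijection `u₁ : Ob1 Γ → Hom(int Γ, U)`, inverse to `F ↦ (Γ, F)`. -/
def u1 : ∀ {Γ : 𝒰.CC} (_ : Ob1 Γ), 𝒰.int.obj Γ ⟶ 𝒰.U
  | _, ⟨⟨0, _⟩, h, _⟩ => absurd h (Nat.lt_irrefl 0)
  | _, ⟨⟨_ + 1, x⟩, _, rfl⟩ => x.2

lemma ext_surj {Γ : 𝒰.CC} (T : Ob1 Γ) : ∃ F, T = ext Γ F := by
  obtain ⟨⟨_ | n, x⟩, h, e⟩ := T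
  · exact absurd h (Nat.lt_irrefl 0)
  · subst e
    exact ⟨x.2, rfl⟩

@[simp] lemma u1_ext (Γ : 𝒰.CC) (F : 𝒰.int.obj Γ ⟶ 𝒰.U) : u1 (ext Γ F) = F := rfl

lemma ext_u1 {Γ : 𝒰.CC} (T : Ob1 Γ) : ext Γ (u1 T) = T := by
  obtain ⟨F, rfl⟩ := ext_surj T
  rfl

/-- The canonical projection, equal to `p_{int Γ, F}` for `T = (Γ, F)`. -/
def prT : ∀ {Γ : 𝒰.CC} (T : Ob1 Γ), 𝒰.int.obj T.obj ⟶ 𝒰.int.obj Γ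
  | _, ⟨⟨0, _⟩, h, _⟩ => absurd h (Nat.lt_irrefl 0)
  | _, ⟨⟨_ + 1, x⟩, _, rfl⟩ => 𝒰.str.pr x.2

/-- The morphism `Q(F) : int T ⟶ Ut` for `T = (Γ, F)`. -/
def QT : ∀ {Γ : 𝒰.CC} (T : Ob1 Γ), 𝒰.int.obj T.obj ⟶ 𝒰.Ut
  | _, ⟨⟨0, _⟩, h, _⟩ => absurd h (Nat.lt_irrefl 0)
  | _, ⟨⟨_ + 1, x⟩, _, rfl⟩ => 𝒰.str.Q x.2

lemma prT_ext (Γ : 𝒰.CC) (F : 𝒰.int.obj Γ ⟶ 𝒰.U) : prT (ext Γ F) = 𝒰.str.pr F := rfl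

lemma QT_ext (Γ : 𝒰.CC) (F : 𝒰.int.obj Γ ⟶ 𝒰.U) : QT (ext Γ F) = 𝒰.str.Q F := rfl

lemma sqT {Γ : 𝒰.CC} (T : Ob1 Γ) : IsPullback (QT T) (prT T) 𝒰.p (u1 T) := by
  obtain ⟨F, rfl⟩ := ext_surj T
  exact 𝒰.str.isPullback F

lemma QT_congr {Γ : 𝒰.CC} {T T' : Ob1 Γ} (h : T = T') :
    𝒰.int.map (eqToHom (congrArg Ob1.obj h)) ≫ QT T' = QT T := by
  subst h; simp

lemma prT_congr {Γ : 𝒰.CC} {T T' : Ob1 Γ} (h : T = T') :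
    𝒰.int.map (eqToHom (congrArg Ob1.obj h)) ≫ prT T' = prT T := by
  subst h; simp

/-- The pull-back `f^* T = (Δ, f ≫ F)` for `T = (Γ, F)`. -/
def pullT {Δ Γ : 𝒰.CC} (f : Δ ⟶ Γ) (T : Ob1 Γ) : Ob1 Δ := ext Δ (𝒰.int.map f ≫ u1 T)

/-- The morphism `q(f, T)`, equal to `Q(f, F)` for `T = (Γ, F)`. -/
noncomputable def qT {Δ Γ : 𝒰.CC} (f : Δ ⟶ Γ) (T : Ob1 Γ) :
    𝒰.int.obj (pullT f T).obj ⟶ 𝒰.int.obj T.obj :=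
  (sqT T).lift (QT (pullT f T)) (prT (pullT f T) ≫ 𝒰.int.map f)
    (by rw [(sqT (pullT f T)).w, Category.assoc]; rfl)

@[simp]
lemma qT_QT {Δ Γ : 𝒰.CC} (f : Δ ⟶ Γ) (T : Ob1 Γ) : qT f T ≫ QT T = QT (pullT f T) := by
  simp [qT]

@[simp]
lemma qT_prT {Δ Γ : 𝒰.CC} (f : Δ ⟶ Γ) (T : Ob1 Γ) :
    qT f T ≫ prT T = prT (pullT f T) ≫ 𝒰.int.map f := by
  simp [qT]

@[simp]
lemma qT_prT_assoc {Δ Γ : 𝒰.CC} (f : Δ ⟶ Γ) (T : Ob1 Γ) {K : C} (k : 𝒰.int.obj Γ ⟶ K) :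
    qT f T ≫ prT T ≫ k = prT (pullT f T) ≫ 𝒰.int.map f ≫ k := by
  simpa only [Category.assoc, Category.id_comp] using congrArg (fun t => t ≫ k) (qT_prT f T)

lemma pullT_id {Γ : 𝒰.CC} (T : Ob1 Γ) : pullT (𝟙 Γ) T = T := by
  simp [pullT, ext_u1]

lemma pullT_comp {Θ Δ Γ : 𝒰.CC} (g : Θ ⟶ Δ) (f : Δ ⟶ Γ) (T : Ob1 Γ) :
    pullT (g ≫ f) T = pullT g (pullT f T) := by
  simp [pullT]

lemma isPullback_qT {Δ Γ : 𝒰.CC} (f : Δ ⟶ Γ) (T : Ob1 Γ) :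
    IsPullback (qT f T) (prT (pullT f T)) (prT T) (𝒰.int.map f) :=
  IsPullback.of_right (by rw [qT_QT]; exact sqT (pullT f T)) (qT_prT f T) (sqT T)

/-- The C-system `CC(C, p)`. -/
noncomputable instance : CSystem.{v, v} 𝒰.CC where
  pt := ⟨0, PUnit.unit⟩
  len_eq_zero := by
    rintro ⟨_ | n, x⟩
    · exact ⟨fun _ => rfl, fun _ => rfl⟩
    · refine ⟨fun h => absurd h (Nat.succ_ne_zero n), fun h => ?_⟩
      exact absurd (congrArg Sigma.fst h) (Nat.succ_ne_zero n)
  len_ft := by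
    rintro ⟨_ | n, x⟩ h
    · exact absurd h (Nat.lt_irrefl 0)
    · rfl
  ft_pt := rfl
  isTerminal := IsTerminal.ofUniqueHom (fun _ => homMk (𝒰.isTerminal.from _))
    (fun _ m => int_inj (𝒰.isTerminal.hom_ext _ _))
  proj T := homMk (prT T)
  pull := pullT
  q f T := homMk (qT f T)
  isPullback f T := IsPullback.of_map_of_faithful 𝒰.int (isPullback_qT f T)
  pull_id := pullT_id
  q_id T := by
    apply int_inj
    apply (sqT T).hom_ext
    · rw [QT_congr (pullT_id T)]; exact qT_QT _ _
    · rw [prT_congr (pullT_id T)]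
      refine (qT_prT _ _).trans ?_
      simp
  pull_comp := pullT_comp
  q_comp g f T := by
    apply int_inj
    apply (sqT T).hom_ext
    · simp only [Functor.map_comp, int_homMk, Category.assoc, qT_QT]
      exact (QT_congr (pullT_comp g f T)).symm
    · simp only [Functor.map_comp, int_homMk, Category.assoc, qT_prT, qT_prT_assoc]
      exact (congrArg (fun t => t ≫ _) (prT_congr (pullT_comp g f T)).symm).trans
        (Category.assoc _ _ _)

end Basic

end UniverseCategory

/-! ### J-structures on the C-system of a universe category -/

namespace UniverseCategory

open CSystem

section JStructures

variable {C : Type u} [Category.{v} C] {𝒰 : UniverseCategory C}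

lemma int_sec_prT {Γ : 𝒰.CC} (o : Tm Γ) : 𝒰.int.map o.sec ≫ prT o.ty = 𝟙 _ := o.sec_proj

/-- The bijection `ũ₁ : Tm Γ → Hom(int Γ, Ut)`, `s ↦ s ≫ Q(u₁(∂ s))`. -/
def ut1 {Γ : 𝒰.CC} (o : Tm Γ) : 𝒰.int.obj Γ ⟶ 𝒰.Ut := 𝒰.int.map o.sec ≫ QT o.ty

/-- The inverse of `ũ₁`. -/
noncomputable def tmMk {Γ : 𝒰.CC} (g : 𝒰.int.obj Γ ⟶ 𝒰.Ut) : Tm Γ where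
  ty := ext Γ (g ≫ 𝒰.p)
  sec := homMk ((sqT (ext Γ (g ≫ 𝒰.p))).lift g (𝟙 _) (by simp))
  sec_proj := (sqT (ext Γ (g ≫ 𝒰.p))).lift_snd g (𝟙 _) (by simp)

@[simp] lemma ut1_tmMk {Γ : 𝒰.CC} (g : 𝒰.int.obj Γ ⟶ 𝒰.Ut) : ut1 (tmMk g) = g :=
  (sqT (ext Γ (g ≫ 𝒰.p))).lift_fst g (𝟙 _) (by simp)

lemma ut1_p {Γ : 𝒰.CC} (o : Tm Γ) : ut1 o ≫ 𝒰.p = u1 o.ty := by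
  rw [ut1, Category.assoc, (sqT o.ty).w, ← Category.assoc, int_sec_prT, Category.id_comp]

lemma ty_eq_of_u1 {Γ : 𝒰.CC} {T T' : Ob1 Γ} (h : u1 T = u1 T') : T = T' := by
  rw [← ext_u1 T, h, ext_u1]

lemma ut1_injective {Γ : 𝒰.CC} {o o' : Tm Γ} (h : ut1 o = ut1 o') : o = o' := by
  have hty : o.ty = o'.ty := ty_eq_of_u1 (by rw [← ut1_p, ← ut1_p, h])
  refine Tm.ext_sec hty (int_inj ?_)
  apply (sqT o'.ty).hom_ext
  · rw [Functor.map_comp, Category.assoc, QT_congr hty]; exact h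
  · rw [Functor.map_comp, Category.assoc, prT_congr hty, int_sec_prT, int_sec_prT]

lemma u1_pull {Δ Γ : 𝒰.CC} (f : Δ ⟶ Γ) (T : Ob1 Γ) :
    u1 (pull f T) = 𝒰.int.map f ≫ u1 T := rfl

lemma int_q_QT {Δ Γ : 𝒰.CC} (f : Δ ⟶ Γ) (T : Ob1 Γ) :
    𝒰.int.map (q f T) ≫ QT T = QT (pull f T) := qT_QT f T

lemma int_proj {Γ : 𝒰.CC} (T : Ob1 Γ) : 𝒰.int.map (proj T) = prT T := rfl

lemma ut1_pull {Δ Γ : 𝒰.CC} (f : Δ ⟶ Γ) (o : Tm Γ) :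
    ut1 (o.pull f) = 𝒰.int.map f ≫ ut1 o := by
  have h := congrArg 𝒰.int.map (o.pullSec_q f)
  simp only [Functor.map_comp] at h
  simp only [ut1]
  rw [← int_q_QT, reassoc_of% h]

lemma ut1_diag {Γ : 𝒰.CC} (T : Ob1 Γ) : ut1 (diag T) = QT T := by
  have h := congrArg 𝒰.int.map (diagSec_q T)
  simp only [Functor.map_comp] at h
  simp only [ut1]
  rw [← int_q_QT, reassoc_of% h]
  exact Category.id_comp _

section IdT

variable (Eq : 𝒰.str.J0)

/-- The J0-structure `IdT_{Eq}` on `CC(C, p)`, where `IdT(o, o')` corresponds under `u₁` to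
`(ũ₁(o) * ũ₁(o')) ≫ Eq`. -/
noncomputable def IdT : CSystem.J0 𝒰.CC where
  IdT {Γ} o o' h := ext Γ (𝒰.str.pair (ut1 o) (ut1 o') (by rw [ut1_p, ut1_p, h]) ≫ Eq)
  natural f o o' h := by
    apply ty_eq_of_u1
    rw [u1_pull, u1_ext, u1_ext, ← Category.assoc]
    congr 1
    apply 𝒰.str.hom_ext <;> simp [ut1_pull]

/-- The middle square: `int (p_T^* T) ⟶ (Ut; p)`. -/
noncomputable def mid {Γ : 𝒰.CC} (T : Ob1 Γ) :
    𝒰.int.obj (pull (proj T) T).obj ⟶ 𝒰.str.ext 𝒰.p :=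
  𝒰.str.pair (prT (pull (proj T) T) ≫ QT T) (QT (pull (proj T) T)) (by
    rw [Category.assoc, (sqT T).w, (sqT (pull (proj T) T)).w]; rfl)

@[simp]
lemma mid_pr {Γ : 𝒰.CC} (T : Ob1 Γ) :
    mid T ≫ 𝒰.str.pr 𝒰.p = prT (pull (proj T) T) ≫ QT T := 𝒰.str.pair_pr _ _ _

@[simp]
lemma mid_Q {Γ : 𝒰.CC} (T : Ob1 Γ) :
    mid T ≫ 𝒰.str.Q 𝒰.p = QT (pull (proj T) T) := 𝒰.str.pair_Q _ _ _

lemma mid_isPullback {Γ : 𝒰.CC} (T : Ob1 Γ) :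
    IsPullback (mid T) (prT (pull (proj T) T)) (𝒰.str.pr 𝒰.p) (QT T) := by
  refine IsPullback.of_right ?_ (mid_pr T) (𝒰.str.isPullback 𝒰.p)
  rw [mid_Q, (sqT T).w]
  exact sqT (pull (proj T) T)

lemma u1_IdxT {Γ : 𝒰.CC} (T : Ob1 Γ) : u1 ((IdT Eq).IdxT T) = mid T ≫ Eq := by
  simp only [CSystem.J0.IdxT, IdT, u1_ext]
  congr 1
  apply 𝒰.str.hom_ext
  · simp only [UnivStr.pair_pr, mid_pr]
    rw [ut1_pull, ut1_diag]; rfl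
  · simp only [UnivStr.pair_Q, mid_Q]
    rw [ut1_diag]

/-- The projection `int (IdxT(T)) ⟶ int Γ`. -/
noncomputable def prE {Γ : 𝒰.CC} (T : Ob1 Γ) :
    𝒰.int.obj ((IdT Eq).IdxT T).obj ⟶ 𝒰.int.obj Γ :=
  prT ((IdT Eq).IdxT T) ≫ prT (pull (proj T) T) ≫ prT T

/-- The projection from `int (IdxT(T))` to `(Ut; p, Eq)`. -/
noncomputable def QE {Γ : 𝒰.CC} (T : Ob1 Γ) :
    𝒰.int.obj ((IdT Eq).IdxT T).obj ⟶ 𝒰.str.ext Eq :=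
  𝒰.str.pair (prT ((IdT Eq).IdxT T) ≫ mid T) (QT ((IdT Eq).IdxT T)) (by
    rw [(sqT ((IdT Eq).IdxT T)).w, u1_IdxT, Category.assoc])

@[simp]
lemma QE_pr {Γ : 𝒰.CC} (T : Ob1 Γ) :
    QE Eq T ≫ 𝒰.str.pr Eq = prT ((IdT Eq).IdxT T) ≫ mid T := 𝒰.str.pair_pr _ _ _

@[simp]
lemma QE_Q {Γ : 𝒰.CC} (T : Ob1 Γ) :
    QE Eq T ≫ 𝒰.str.Q Eq = QT ((IdT Eq).IdxT T) := 𝒰.str.pair_Q _ _ _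

/-- `int (IdxT(T))` is the pull-back of `pE` along `u₁(T)`. -/
lemma sqE {Γ : 𝒰.CC} (T : Ob1 Γ) :
    IsPullback (QE Eq T) (prE Eq T) (UnivStr.pE Eq) (u1 T) := by
  have h1 : IsPullback (QE Eq T) (prT ((IdT Eq).IdxT T)) (𝒰.str.pr Eq) (mid T) := by
    refine IsPullback.of_right ?_ (QE_pr Eq T) (𝒰.str.isPullback Eq)
    rw [QE_Q, ← u1_IdxT]
    exact sqT _
  exact h1.paste_vert ((mid_isPullback T).paste_vert (sqT T))

end IdT

section refl

variable {Eq : 𝒰.str.J0} (Om : UnivStr.J1 Eq)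

/-- The J1-structure `refl_Ω` on `CC(C, p)`, where `refl(s)` corresponds under `ũ₁` to
`ũ₁(s) ≫ Ω`. -/
noncomputable def refl : CSystem.J1 (IdT Eq) where
  refl o := tmMk (ut1 o ≫ Om.Om)
  natural f o := by
    apply ut1_injective
    rw [ut1_pull, ut1_tmMk, ut1_tmMk, ut1_pull, Category.assoc]
  ty_refl {Γ} o := by
    apply ty_eq_of_u1
    rw [← ut1_p, ut1_tmMk, Category.assoc, Om.comm]
    simp only [IdT, u1_ext, ← Category.assoc]
    congr 1
    apply 𝒰.str.hom_ext <;> simp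

lemma _root_.CSystem.J1.rf_proj {CC : Type w} [CSystem.{w, v} CC] {I : CSystem.J0 CC}
    (R : CSystem.J1 I) {Γ : CC} (T : Ob1 Γ) : R.rf T ≫ proj (I.IdxT T) = diagSec T := by
  have h := (CSystem.isPullback (diagSec T) (I.IdxT T)).w
  have hty : (R.refl (diag T)).ty = pull (diagSec T) (I.IdxT T) :=
    (R.ty_refl (diag T)).trans (I.diag_pull_IdxT T).symm
  rw [CSystem.J1.rf, Category.assoc, Category.assoc, h, ← Category.assoc (eqToHom _),
    proj_congr hty, ← Category.assoc, (R.refl (diag T)).sec_proj, Category.id_comp]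

lemma rf_prE {Γ : 𝒰.CC} (T : Ob1 Γ) : 𝒰.int.map ((refl Om).rf T) ≫ prE Eq T = prT T := by
  have h := congrArg 𝒰.int.map ((refl Om).rf_proj T)
  have h' := congrArg 𝒰.int.map (diagSec_proj T)
  simp only [Functor.map_comp, int_proj] at h h'
  rw [prE, reassoc_of% h, reassoc_of% h']
  exact Category.id_comp _

lemma rf_QE {Γ : 𝒰.CC} (T : Ob1 Γ) :
    𝒰.int.map ((refl Om).rf T) ≫ QE Eq T = QT T ≫ Om.om := by
  have h := congrArg 𝒰.int.map ((refl Om).rf_proj T)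
  have h' := congrArg 𝒰.int.map (diagSec_proj T)
  have hd := ut1_diag T
  simp only [ut1] at hd
  simp only [Functor.map_comp, int_proj] at h h'
  apply 𝒰.str.hom_ext
  · simp only [Category.assoc, QE_pr, UnivStr.J1.om_pr]
    rw [reassoc_of% h]
    apply 𝒰.str.hom_ext
    · simp [reassoc_of% h']
    · simp [hd]
  · simp only [Category.assoc, QE_Q, UnivStr.J1.om_Q]
    have hty : ((refl Om).refl (diag T)).ty = pull (diagSec T) ((IdT Eq).IdxT T) :=
      ((refl Om).ty_refl (diag T)).trans ((IdT Eq).diag_pull_IdxT T).symm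
    rw [CSystem.J1.rf, Functor.map_comp, Functor.map_comp, Category.assoc, Category.assoc,
      int_q_QT, QT_congr hty]
    change ut1 ((refl Om).refl (diag T)) = _
    rw [← ut1_diag T]
    exact ut1_tmMk _

end refl

section J

variable (L : LCCStr C) {Eq : 𝒰.str.J0} {Om : UnivStr.J1 Eq}

/-- The element of `D_{pE}(int Γ, V)` given by `u₁(T)` and a morphism `int (IdxT(T)) ⟶ V`. Here
`int (IdxT(T))` is identified with `(int Γ; u₁(T))_E`. -/
noncomputable def dE {Γ : 𝒰.CC} (T : Ob1 Γ) {V : C}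
    (a : 𝒰.int.obj ((IdT Eq).IdxT T).obj ⟶ V) : (UnivStr.E Eq).D (𝒰.int.obj Γ) V :=
  (UnivStr.E Eq).mkD (sqE Eq T) a

/-- The element of `D_p(int Γ, V)` given by `u₁(T)` and a morphism `int T ⟶ V`. -/
noncomputable def dT {Γ : 𝒰.CC} (T : Ob1 Γ) {V : C} (a : 𝒰.int.obj T.obj ⟶ V) :
    𝒰.str.D (𝒰.int.obj Γ) V :=
  𝒰.str.mkD (sqT T) a

lemma Dstar_dE {Γ : 𝒰.CC} (T : Ob1 Γ) {V : C} (a : 𝒰.int.obj ((IdT Eq).IdxT T).obj ⟶ V) :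
    (UnivStr.E Eq).Dstar 𝒰.str Om.om Om.om_pE (dE T a) =
      dT T (𝒰.int.map ((refl Om).rf T) ≫ a) :=
  UnivStr.mkD_Dstar _ _ _ _ _ (sqT T) _ (rf_QE Om T) (rf_prE Om T) a

lemma int_q2_QT {Δ Γ : 𝒰.CC} (f : Δ ⟶ Γ) (T : Ob1 Γ) :
    𝒰.int.map (q2 f T) ≫ QT (pull (proj T) T) = QT (pull (proj (pull f T)) (pull f T)) := by
  have h : pull (proj (pull f T)) (pull f T) = pull (q f T) (pull (proj T) T) := by
    rw [← CSystem.pull_comp, ← CSystem.pull_comp, (CSystem.isPullback f T).w]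
  rw [q2, Functor.map_comp, Category.assoc, int_q_QT, QT_congr h]

lemma int_q2_prT {Δ Γ : 𝒰.CC} (f : Δ ⟶ Γ) (T : Ob1 Γ) :
    𝒰.int.map (q2 f T) ≫ prT (pull (proj T) T) =
      prT (pull (proj (pull f T)) (pull f T)) ≫ 𝒰.int.map (q f T) := by
  have h := congrArg 𝒰.int.map (q2_proj f T)
  simpa only [Functor.map_comp, int_proj] using h

lemma int_q3_QT {Δ Γ : 𝒰.CC} (f : Δ ⟶ Γ) (T : Ob1 Γ) :
    𝒰.int.map ((IdT Eq).q3 f T) ≫ QT ((IdT Eq).IdxT T) = QT ((IdT Eq).IdxT (pull f T)) := by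
  rw [CSystem.J0.q3, Functor.map_comp, Category.assoc, int_q_QT,
    QT_congr ((IdT Eq).IdxT_natural f T)]

lemma int_q3_prT {Δ Γ : 𝒰.CC} (f : Δ ⟶ Γ) (T : Ob1 Γ) :
    𝒰.int.map ((IdT Eq).q3 f T) ≫ prT ((IdT Eq).IdxT T) =
      prT ((IdT Eq).IdxT (pull f T)) ≫ 𝒰.int.map (q2 f T) := by
  have h := congrArg 𝒰.int.map (CSystem.isPullback (q2 f T) ((IdT Eq).IdxT T)).w
  simp only [Functor.map_comp, int_proj] at h
  rw [CSystem.J0.q3, Functor.map_comp, Category.assoc, h, ← Category.assoc,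
    prT_congr ((IdT Eq).IdxT_natural f T)]

lemma int_q_prT {Δ Γ : 𝒰.CC} (f : Δ ⟶ Γ) (T : Ob1 Γ) :
    𝒰.int.map (q f T) ≫ prT T = prT (pull f T) ≫ 𝒰.int.map f := qT_prT f T

lemma int_q3_QE {Δ Γ : 𝒰.CC} (f : Δ ⟶ Γ) (T : Ob1 Γ) :
    𝒰.int.map ((IdT Eq).q3 f T) ≫ QE Eq T = QE Eq (pull f T) := by
  apply 𝒰.str.hom_ext
  · simp only [Category.assoc, QE_pr]
    rw [← Category.assoc, int_q3_prT, Category.assoc]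
    congr 1
    apply 𝒰.str.hom_ext
    · simp only [Category.assoc, mid_pr]
      rw [← Category.assoc, int_q2_prT, Category.assoc, int_q_QT]
    · simp only [Category.assoc, mid_Q]
      rw [int_q2_QT]
  · simp only [Category.assoc, QE_Q]
    rw [int_q3_QT]

lemma int_q3_prE {Δ Γ : 𝒰.CC} (f : Δ ⟶ Γ) (T : Ob1 Γ) :
    𝒰.int.map ((IdT Eq).q3 f T) ≫ prE Eq T = prE Eq (pull f T) ≫ 𝒰.int.map f := by
  simp only [prE, Category.assoc]
  rw [← Category.assoc, int_q3_prT, Category.assoc]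
  congr 1
  rw [← Category.assoc, int_q2_prT, Category.assoc, int_q_prT]

lemma Dpre_dE {Δ Γ : 𝒰.CC} (f : Δ ⟶ Γ) (T : Ob1 Γ) {V : C}
    (a : 𝒰.int.obj ((IdT Eq).IdxT T).obj ⟶ V) :
    (UnivStr.E Eq).Dpre (𝒰.int.map f) (dE T a) =
      dE (pull f T) (𝒰.int.map ((IdT Eq).q3 f T) ≫ a) :=
  UnivStr.mkD_Dpre _ _ _ (sqE Eq (pull f T)) _ (int_q3_QE f T) (int_q3_prE f T) a

lemma Dpre_dT {Δ Γ : 𝒰.CC} (f : Δ ⟶ Γ) (T : Ob1 Γ) {V : C} (a : 𝒰.int.obj T.obj ⟶ V) :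
    𝒰.str.Dpre (𝒰.int.map f) (dT T a) = dT (pull f T) (𝒰.int.map (q f T) ≫ a) :=
  UnivStr.mkD_Dpre _ _ _ (sqT (pull f T)) _ (int_q_QT f T) (int_q_prT f T) a

/-- The morphism `φ(Γ, T, P, s0)` from `int Γ` to the fiber product of `I_{pE}(U)` and `I_p(Ut)`
over `I_p(U)`, with the components `η_{pE}(u₁(T), u₁(P))` and `η_p(u₁(T), ũ₁(s0))`. -/
noncomputable def phiJ {Γ : 𝒰.CC} (T : Ob1 Γ) (P : Ob1 ((IdT Eq).IdxT T).obj) (s0 : Tm T.obj)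
    (h : s0.ty = pull ((refl Om).rf T) P) : 𝒰.int.obj Γ ⟶ L.Fp 𝒰.isTerminal Om :=
  L.lift (L.eta 𝒰.isTerminal (UnivStr.E Eq) _ _ (dE T (u1 P)))
    (L.eta 𝒰.isTerminal 𝒰.str _ _ (dT T (ut1 s0))) (by
      rw [← L.eta_Dstar 𝒰.isTerminal (UnivStr.E Eq) 𝒰.str, Dstar_dE,
        ← L.eta_Dmap 𝒰.isTerminal 𝒰.str, dT, dT, UnivStr.mkD_Dmap, ut1_p, h, u1_pull])

variable {L} (S : UnivStr.J2 L 𝒰.isTerminal Om)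

lemma Jp_fst : S.Jp ≫ L.Imap 𝒰.isTerminal (UnivStr.pE Eq) 𝒰.p = L.fst _ _ := by
  have h := congrArg (fun t => t ≫ L.fst _ _) S.Jp_coJ
  simpa [LCCStr.coJ] using h

lemma Jp_snd : S.Jp ≫ L.Iom 𝒰.isTerminal Om 𝒰.Ut = L.snd _ _ := by
  have h := congrArg (fun t => t ≫ L.snd _ _) S.Jp_coJ
  simpa [LCCStr.coJ] using h

/-- The element `η^!_{pE}(φ(Γ, T, P, s0) ≫ Jp)` of `D_{pE}(int Γ, Ut)`. -/
noncomputable def dJ {Γ : 𝒰.CC} (T : Ob1 Γ) (P : Ob1 ((IdT Eq).IdxT T).obj) (s0 : Tm T.obj)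
    (h : s0.ty = pull ((refl Om).rf T) P) : (UnivStr.E Eq).D (𝒰.int.obj Γ) 𝒰.Ut :=
  L.etaInv 𝒰.isTerminal (UnivStr.E Eq) (phiJ L T P s0 h ≫ S.Jp)

lemma Dmap_dJ {Γ : 𝒰.CC} (T : Ob1 Γ) (P : Ob1 ((IdT Eq).IdxT T).obj) (s0 : Tm T.obj)
    (h : s0.ty = pull ((refl Om).rf T) P) :
    (UnivStr.E Eq).Dmap 𝒰.p (dJ S T P s0 h) = dE T (u1 P) := by
  rw [dJ, ← L.etaInv_Imap 𝒰.isTerminal (UnivStr.E Eq), Category.assoc, Jp_fst, phiJ,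
    LCCStr.lift_fst, L.etaInv_eta]

lemma dJ_fst {Γ : 𝒰.CC} (T : Ob1 Γ) (P : Ob1 ((IdT Eq).IdxT T).obj) (s0 : Tm T.obj)
    (h : s0.ty = pull ((refl Om).rf T) P) : (dJ S T P s0 h).1 = u1 T :=
  congrArg Sigma.fst (Dmap_dJ S T P s0 h)

/-- The section `J(Γ, T, P, s0)`, the unique one with
`η_{pE}(u₁(T), ũ₁(J)) = φ(Γ, T, P, s0) ≫ Jp`. -/
noncomputable def secJ {Γ : 𝒰.CC} (T : Ob1 Γ) (P : Ob1 ((IdT Eq).IdxT T).obj) (s0 : Tm T.obj)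
    (h : s0.ty = pull ((refl Om).rf T) P) : Tm ((IdT Eq).IdxT T).obj :=
  tmMk ((UnivStr.E Eq).unD (sqE Eq T) (dJ S T P s0 h) (dJ_fst S T P s0 h))

lemma dE_secJ {Γ : 𝒰.CC} (T : Ob1 Γ) (P : Ob1 ((IdT Eq).IdxT T).obj) (s0 : Tm T.obj)
    (h : s0.ty = pull ((refl Om).rf T) P) :
    dE T (ut1 (secJ S T P s0 h)) = dJ S T P s0 h := by
  rw [secJ, ut1_tmMk]
  exact UnivStr.mkD_unD _ _ _ _

lemma eta_secJ {Γ : 𝒰.CC} (T : Ob1 Γ) (P : Ob1 ((IdT Eq).IdxT T).obj) (s0 : Tm T.obj)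
    (h : s0.ty = pull ((refl Om).rf T) P) :
    L.eta 𝒰.isTerminal (UnivStr.E Eq) _ _ (dE T (ut1 (secJ S T P s0 h))) =
      phiJ L T P s0 h ≫ S.Jp := by
  rw [dE_secJ, dJ, L.eta_etaInv]

/-- The J2-structure `J_{Jp}` on `CC(C, p)`. -/
noncomputable def J : CSystem.J2 (refl Om) where
  J T P s0 h := secJ S T P s0 h
  ty_J T P s0 h := by
    apply ty_eq_of_u1
    rw [← ut1_p]
    apply UnivStr.mkD_injective (UnivStr.E Eq) (sqE Eq T)
    have e := Dmap_dJ S T P s0 h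
    rw [← dE_secJ, dE, UnivStr.mkD_Dmap] at e
    exact e
  natural {Δ Γ} f T P s0 h := by
    have hphi : ∀ h', 𝒰.int.map f ≫ phiJ L T P s0 h =
        phiJ L (pull f T) (pull ((IdT Eq).q3 f T) P) (s0.pull (q f T)) h' := by
      intro h'
      apply L.hom_ext
      · simp only [phiJ, Category.assoc, LCCStr.lift_fst]
        rw [← L.eta_Dpre, Dpre_dE, u1_pull]
      · simp only [phiJ, Category.assoc, LCCStr.lift_snd]
        rw [← L.eta_Dpre, Dpre_dT, ut1_pull]
    apply ut1_injective
    apply UnivStr.mkD_injective (UnivStr.E Eq) (sqE Eq (pull f T))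
    apply (L.eta 𝒰.isTerminal (UnivStr.E Eq) _ _).injective
    refine _root_.Eq.trans ?_ (eta_secJ S (pull f T) _ _ _).symm
    rw [ut1_pull, ← hphi, Category.assoc, ← eta_secJ, ← L.eta_Dpre, Dpre_dE]
    rfl
  iota {Γ} T P s0 h := by
    apply ut1_injective
    apply UnivStr.mkD_injective 𝒰.str (sqT T)
    apply (L.eta 𝒰.isTerminal 𝒰.str _ _).injective
    have e := L.eta_Dstar 𝒰.isTerminal (UnivStr.E Eq) 𝒰.str Om.om Om.om_pE
      (dE T (ut1 (secJ S T P s0 h)))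
    rw [Dstar_dE, eta_secJ, Category.assoc, Jp_snd, phiJ, LCCStr.lift_snd] at e
    rw [ut1_pull]
    exact e

end J

end JStructures

end UniverseCategory

/-! ### The homomorphism of C-systems defined by a universe category functor -/

/-- A functor of universe categories: a functor `F` with morphisms `φ` and `φt` such that `F` takes
the canonical squares of `𝒰` to pull-back squares and the final object to a final object, and the
square formed by `φ` and `φt` is a pull-back square. -/
structure UniverseFunctor {C : Type u} [Category.{v} C] {C' : Type u'} [Category.{v'} C']
    (𝒰 : UniverseCategory C) (𝒰' : UniverseCategory C') where
  F : C ⥤ C'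
  φ : F.obj 𝒰.U ⟶ 𝒰'.U
  φt : F.obj 𝒰.Ut ⟶ 𝒰'.Ut
  isUniv : IsUnivFunctor 𝒰.str 𝒰'.str F φ φt
  isTerminal : IsTerminal (F.obj 𝒰.pt)

namespace UniverseFunctor

open CSystem UniverseCategory

section

variable {C : Type u} [Category.{v} C] {C' : Type u'} [Category.{v'} C']
  {𝒰 : UniverseCategory C} {𝒰' : UniverseCategory C'} (Φ : UniverseFunctor 𝒰 𝒰')

/-- For an isomorphism `ψ : X' ≅ Φ(X)` and `G : X ⟶ U`, the isomorphism
`(X'; ψ ≫ Φ(G) ≫ φ)' ≅ Φ((X; G))`. -/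
noncomputable def psiExt {X : C} {X' : C'} (ψ : X' ≅ Φ.F.obj X) (G : X ⟶ 𝒰.U) :
    𝒰'.str.ext (ψ.hom ≫ Φ.F.map G ≫ Φ.φ) ≅ Φ.F.obj (𝒰.str.ext G) where
  hom := (Φ.isUniv.sq G).lift (𝒰'.str.Q _) (𝒰'.str.pr _ ≫ ψ.hom)
    (by rw [𝒰'.str.w, Category.assoc])
  inv := 𝒰'.str.pair (Φ.F.map (𝒰.str.pr G) ≫ ψ.inv) (Φ.F.map (𝒰.str.Q G) ≫ Φ.φt)
    (by simpa using (Φ.isUniv.sq G).w.symm)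
  hom_inv_id := by
    apply 𝒰'.str.hom_ext
    · have h := (Φ.isUniv.sq G).lift_snd (𝒰'.str.Q (ψ.hom ≫ Φ.F.map G ≫ Φ.φ))
        (𝒰'.str.pr _ ≫ ψ.hom) (by rw [𝒰'.str.w, Category.assoc])
      simp [reassoc_of% h]
    · have h := (Φ.isUniv.sq G).lift_fst (𝒰'.str.Q (ψ.hom ≫ Φ.F.map G ≫ Φ.φ))
        (𝒰'.str.pr _ ≫ ψ.hom) (by rw [𝒰'.str.w, Category.assoc])
      simp [h]
  inv_hom_id := by
    apply (Φ.isUniv.sq G).hom_ext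
    · rw [Category.assoc, IsPullback.lift_fst, UnivStr.pair_Q, Category.id_comp]
    · rw [Category.assoc, IsPullback.lift_snd, UnivStr.pair_pr_assoc, Category.assoc,
        Iso.inv_hom_id, Category.comp_id, Category.id_comp]

lemma psiExt_Q {X : C} {X' : C'} (ψ : X' ≅ Φ.F.obj X) (G : X ⟶ 𝒰.U) :
    (Φ.psiExt ψ G).hom ≫ Φ.F.map (𝒰.str.Q G) ≫ Φ.φt = 𝒰'.str.Q _ :=
  (Φ.isUniv.sq G).lift_fst _ _ _

lemma psiExt_pr {X : C} {X' : C'} (ψ : X' ≅ Φ.F.obj X) (G : X ⟶ 𝒰.U) :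
    (Φ.psiExt ψ G).hom ≫ Φ.F.map (𝒰.str.pr G) = 𝒰'.str.pr _ ≫ ψ.hom :=
  (Φ.isUniv.sq G).lift_snd _ _ _

/-- The object `H(Γ)` with the isomorphism `ψ(Γ) : int' (H(Γ)) ≅ Φ(int Γ)`, by recursion on the
length: `H(Γ, G) = (H(Γ), ψ(Γ) ≫ Φ(G) ≫ φ)`. -/
noncomputable def hctx : ∀ (n : ℕ) (Γ : (𝒰.ctx n).1),
    Σ Γ' : (𝒰'.ctx n).1, ((𝒰'.ctx n).2 Γ' ≅ Φ.F.obj ((𝒰.ctx n).2 Γ))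
  | 0, _ => ⟨PUnit.unit, 𝒰'.isTerminal.uniqueUpToIso Φ.isTerminal⟩
  | n + 1, x => ⟨⟨(hctx n x.1).1, (hctx n x.1).2.hom ≫ Φ.F.map x.2 ≫ Φ.φ⟩,
      Φ.psiExt (hctx n x.1).2 x.2⟩

/-- The object `H(Γ)`. -/
noncomputable def hObj (Γ : 𝒰.CC) : 𝒰'.CC := ⟨Γ.1, (Φ.hctx Γ.1 Γ.2).1⟩

/-- The isomorphism `ψ(Γ)`, before `H` is known to be a functor. -/
noncomputable def psi₀ (Γ : 𝒰.CC) : 𝒰'.int.obj (Φ.hObj Γ) ≅ Φ.F.obj (𝒰.int.obj Γ) :=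
  (Φ.hctx Γ.1 Γ.2).2

/-- The functor `H`, with `H(f) = ψ(Γ) ≫ Φ(f) ≫ ψ(Δ)⁻¹`, commuting with lengths and `ft`. -/
noncomputable def hFunctor : LengthFunctor 𝒰.CC 𝒰'.CC where
  obj := Φ.hObj
  map {Γ Δ} f := homMk ((Φ.psi₀ Γ).hom ≫ Φ.F.map (𝒰.int.map f) ≫ (Φ.psi₀ Δ).inv)
  map_id Γ := int_inj (by simp)
  map_comp f g := int_inj (by simp)
  len_obj _ := rfl
  ft_obj
    | ⟨0, _⟩ => rfl
    | ⟨_ + 1, _⟩ => rfl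

/-- The isomorphism `ψ(Γ) : int' (H(Γ)) ≅ Φ(int Γ)`. -/
noncomputable def psi (Γ : 𝒰.CC) :
    𝒰'.int.obj (Φ.hFunctor.obj Γ) ≅ Φ.F.obj (𝒰.int.obj Γ) := Φ.psi₀ Γ

lemma int_hFunctor {Γ Δ : 𝒰.CC} (f : Γ ⟶ Δ) :
    𝒰'.int.map (Φ.hFunctor.map f) =
      (Φ.psi Γ).hom ≫ Φ.F.map (𝒰.int.map f) ≫ (Φ.psi Δ).inv := rfl

lemma u1_ob1 {Γ : 𝒰.CC} (T : Ob1 Γ) :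
    u1 (Φ.hFunctor.ob1 T) = (Φ.psi Γ).hom ≫ Φ.F.map (u1 T) ≫ Φ.φ := by
  obtain ⟨G, rfl⟩ := ext_surj T
  rfl

lemma psi_QT {Γ : 𝒰.CC} (T : Ob1 Γ) :
    (Φ.psi T.obj).hom ≫ Φ.F.map (QT T) ≫ Φ.φt = QT (Φ.hFunctor.ob1 T) := by
  obtain ⟨G, rfl⟩ := ext_surj T
  exact Φ.psiExt_Q _ _

lemma psi_prT {Γ : 𝒰.CC} (T : Ob1 Γ) :
    (Φ.psi T.obj).hom ≫ Φ.F.map (prT T) = prT (Φ.hFunctor.ob1 T) ≫ (Φ.psi Γ).hom := by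
  obtain ⟨G, rfl⟩ := ext_surj T
  exact Φ.psiExt_pr _ _

/-- The homomorphism of C-systems `H : CC(C, p) ⟶ CC(C', p')`. -/
noncomputable def H : CHom 𝒰.CC 𝒰'.CC where
  toLengthFunctor := Φ.hFunctor
  map_proj {Γ} T := by
    apply int_inj
    refine (Φ.int_hFunctor _).trans ?_
    rw [← Category.assoc]
    refine (congrArg (fun t => t ≫ (Φ.psi Γ).inv) (Φ.psi_prT T)).trans ?_
    exact (Category.assoc _ _ _).trans ((congrArg (fun t => _ ≫ t) (Φ.psi Γ).hom_inv_id).trans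
      (Category.comp_id _))
  ob1_pull {Δ Γ} f T := by
    apply ty_eq_of_u1
    rw [u1_ob1, u1_pull, u1_pull, u1_ob1, int_hFunctor]
    simp
  map_q {Δ Γ} f T := by
    have hty : Φ.hFunctor.ob1 (pull f T) = pull (Φ.hFunctor.map f) (Φ.hFunctor.ob1 T) := by
      apply ty_eq_of_u1
      rw [u1_ob1, u1_pull, u1_pull, u1_ob1, int_hFunctor]
      simp
    apply int_inj
    apply (sqT (Φ.hFunctor.ob1 T)).hom_ext
    · rw [Functor.map_comp, Category.assoc, int_q_QT, QT_congr hty, ← psi_QT Φ T, ← psi_QT Φ (pull f T),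
        int_hFunctor, ← int_q_QT f T]
      simp
    · have h := qT_prT (Φ.hFunctor.map f) (Φ.hFunctor.ob1 T)
      have h2 : 𝒰.int.map (q f T) ≫ prT T = prT (pull f T) ≫ 𝒰.int.map f := qT_prT f T
      rw [Functor.map_comp, Category.assoc]
      refine _root_.Eq.trans ?_ (congrArg (fun t => _ ≫ t) h).symm
      rw [← Category.assoc (𝒰'.int.map (eqToHom _))]
      refine _root_.Eq.trans ?_ (congrArg (fun t => t ≫ _) (prT_congr hty)).symm
      rw [int_hFunctor, int_hFunctor, ← cancel_mono (Φ.psi Γ).hom]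
      simp only [Category.assoc, Iso.inv_hom_id, Category.comp_id]
      rw [← Category.assoc (prT _), ← psi_prT, ← psi_prT]
      simp only [Category.assoc, Iso.inv_hom_id_assoc]
      rw [← Φ.F.map_comp, ← Φ.F.map_comp, h2]

end

end UniverseFunctor

/-!
On `CC(C, p)` all three operations are defined by composing the classifying morphisms `u₁(T)` and
`ũ₁(s)` with a fixed morphism of `C`, namely `Eq`, `Ω` or `Jp`. The homomorphism `H` acts on
classifying morphisms by `g ↦ ψ ≫ Φ(g) ≫ φ` and `g ↦ ψ ≫ Φ(g) ≫ φt` (`u1_H`, `ut1_H`), and `u₁`,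
`ũ₁` are injective, so preservation of `IdT` and `refl` is the compatibility of `Φ` with `Eq` and `Ω`.

For `J` the section is determined by an element of `D_{pE}(int Γ, Ut)`, which is a morphism out of
`int (IdxT(T))` viewed as a pull-back of `pE`. The isomorphism `ψ` at `IdxT(T)` identifies the square
of `IdxT'(H(T))` with the image of that of `IdxT(T)` (`psiIdx_QE`, `psiIdx_prE`). As the adjunction
bijections are natural and `χ` is defined by applying `Φ` to the universal element, adjoints in `C`
are taken to adjoints in `C'` (`psi_map_eta_dE`, `psi_map_eta_dT`). Applied to the two components of
`φ(Γ, T, P, s0)` this gives the compatibility of these morphisms with `R` (`psi_map_phiJ_R`); applied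
to `J` itself, together with the compatibility of `Φ` with `Jp`, it gives the claim.
-/

/-! ### Universe functors and arbitrary pull-backs of the universe -/

namespace IsUnivFunctor

variable {C : Type u} [Category.{v} C] {C' : Type u'} [Category.{v'} C']
  {U Ut : C} {p : Ut ⟶ U} {U' Ut' : C'} {p' : Ut' ⟶ U'}
  {P : UnivStr p} {P' : UnivStr p'} {Φ : C ⥤ C'} {φ : Φ.obj U ⟶ U'} {φt : Φ.obj Ut ⟶ Ut'}

/-- The action of `Φ²` on an element given by an arbitrary pull-back `Z` of `p` along `F`, restricted
along `f : X' ⟶ Φ(X)`: it is given by any pull-back `Z₁` of `p'` along `F'`, with the morphism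
`r : Z₁ ⟶ Φ(Z)` over `f`. -/
lemma Dpre_Phi2_mkD (h : IsUnivFunctor P P' Φ φ φt) {X V Z : C} {F : X ⟶ U} {z : Z ⟶ Ut}
    {z' : Z ⟶ X} (sq : IsPullback z z' p F) {X' Z₁ : C'} (f : X' ⟶ Φ.obj X) {F' : X' ⟶ U'}
    (hF : F' = f ≫ Φ.map F ≫ φ) {z₁ : Z₁ ⟶ Ut'} {z₁' : Z₁ ⟶ X'}
    (sq₁ : IsPullback z₁ z₁' p' F') (r : Z₁ ⟶ Φ.obj Z) (h1 : r ≫ Φ.map z ≫ φt = z₁)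
    (h2 : r ≫ Φ.map z' = z₁' ≫ f) (a : Z ⟶ V) :
    P'.Dpre f (h.Phi2 (P.mkD sq a)) = P'.mkD sq₁ (r ≫ Φ.map a) := by
  subst hF
  -- The comparison of `Z` with `(X; F)` is invertible, so it is enough to compare maps to `Φ((X; F))`.
  have e : P.pair z' z sq.w.symm ≫ sq.lift (P.Q F) (P.pr F) (P.w F) = 𝟙 _ := by
    apply sq.hom_ext <;> simp
  have hz : Φ.map (P.pair z' z sq.w.symm) ≫ Φ.map (P.Q F) = Φ.map z := by
    rw [← Φ.map_comp, UnivStr.pair_Q]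
  have hz' : Φ.map (P.pair z' z sq.w.symm) ≫ Φ.map (P.pr F) = Φ.map z' := by
    rw [← Φ.map_comp, UnivStr.pair_pr]
  have key : P'.Qm f (Φ.map F ≫ φ) ≫ h.iota F =
      sq₁.lift (P'.Q _) (P'.pr _) (P'.w _) ≫ r ≫ Φ.map (P.pair z' z sq.w.symm) := by
    apply (h.sq F).hom_ext
    · simp only [Category.assoc, h.iota_Q, UnivStr.Qm_Q]
      rw [reassoc_of% hz, h1, IsPullback.lift_fst]
    · simp only [Category.assoc, h.iota_pr, UnivStr.Qm_pr]
      rw [hz', h2, IsPullback.lift_snd_assoc]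
  refine congrArg (Sigma.mk _) ?_
  change P'.Qm f (Φ.map F ≫ φ) ≫ h.iota F ≫ Φ.map (sq.lift (P.Q F) (P.pr F) (P.w F) ≫ a) = _
  rw [reassoc_of% key, ← Φ.map_comp, reassoc_of% e]

end IsUnivFunctor

/-! ### Transport along equalities of contexts -/

namespace UniverseCategory

open CSystem

variable {C : Type u} [Category.{v} C] {𝒰 : UniverseCategory C}

lemma ut1_cast {Γ Γ' : 𝒰.CC} (e : Γ = Γ') (o : Tm Γ) :
    ut1 (o.cast e) = 𝒰.int.map (eqToHom e.symm) ≫ ut1 o := by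
  subst e; simp [Tm.cast]

lemma u1_cast {Γ Γ' : 𝒰.CC} (e : Γ = Γ') (T : Ob1 Γ) :
    u1 (T.cast e) = 𝒰.int.map (eqToHom e.symm) ≫ u1 T := by
  subst e; simp

/-- For objects over equal but not definitionally equal bases, `T = (eqToHom e)^* T'` says that `T`
and `T'` agree; then so do their morphisms `Q`. -/
lemma QT_of_eq_pull_eqToHom {Γ Γ' : 𝒰.CC} (e : Γ = Γ') {T : Ob1 Γ} {T' : Ob1 Γ'}
    (hT : T = pull (eqToHom e) T') (e' : T.obj = T'.obj) :
    𝒰.int.map (eqToHom e') ≫ QT T' = QT T := by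
  subst e
  rw [eqToHom_refl, CSystem.pull_id] at hT
  exact QT_congr hT

lemma prT_of_eq_pull_eqToHom {Γ Γ' : 𝒰.CC} (e : Γ = Γ') {T : Ob1 Γ} {T' : Ob1 Γ'}
    (hT : T = pull (eqToHom e) T') (e' : T.obj = T'.obj) :
    𝒰.int.map (eqToHom e') ≫ prT T' = prT T ≫ 𝒰.int.map (eqToHom e) := by
  subst e
  rw [eqToHom_refl, CSystem.pull_id] at hT
  rw [prT_congr hT]
  simp

end UniverseCategory

/-! ### The homomorphism `H` and J-structures -/

namespace UniverseFunctor

open CSystem UniverseCategory IsUnivFunctor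

variable {C : Type u} [Category.{v} C] {C' : Type u'} [Category.{v'} C']
  {𝒰 : UniverseCategory C} {𝒰' : UniverseCategory C'} (Φ : UniverseFunctor 𝒰 𝒰')

/-- The isomorphism `ψ(Γ)`, with its source expressed through the homomorphism of C-systems `H`. -/
noncomputable def psiH (Γ : 𝒰.CC) : 𝒰'.int.obj (Φ.H.obj Γ) ≅ Φ.F.obj (𝒰.int.obj Γ) := Φ.psi Γ

lemma u1_H {Γ : 𝒰.CC} (T : Ob1 Γ) :
    u1 (Φ.H.ob1 T) = (Φ.psiH Γ).hom ≫ Φ.F.map (u1 T) ≫ Φ.φ := Φ.u1_ob1 T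

lemma QT_H {Γ : 𝒰.CC} (T : Ob1 Γ) :
    QT (Φ.H.ob1 T) = (Φ.psiH T.obj).hom ≫ Φ.F.map (QT T) ≫ Φ.φt := (Φ.psi_QT T).symm

lemma prT_H {Γ : 𝒰.CC} (T : Ob1 Γ) :
    prT (Φ.H.ob1 T) ≫ (Φ.psiH Γ).hom = (Φ.psiH T.obj).hom ≫ Φ.F.map (prT T) := (Φ.psi_prT T).symm

/-- Under `u₁` and `ũ₁`, the homomorphism `H` acts as `Φ` followed by `φ` and `φt`, up to `ψ`. -/
lemma ut1_H {Γ : 𝒰.CC} (o : Tm Γ) :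
    ut1 (Φ.H.tm o) = (Φ.psiH Γ).hom ≫ Φ.F.map (ut1 o) ≫ Φ.φt := by
  have h : 𝒰'.int.map (Φ.H.map o.sec) =
      (Φ.psiH Γ).hom ≫ Φ.F.map (𝒰.int.map o.sec) ≫ (Φ.psiH o.ty.obj).inv := Φ.int_hFunctor o.sec
  rw [ut1, h, QT_H]
  simp [ut1]

variable {Φ} {EqU : 𝒰.str.J0} {EqU' : 𝒰'.str.J0}

theorem isJ0Hom_H (h0 : Φ.isUniv.CompatJ0 EqU EqU') : IsJ0Hom Φ.H (IdT EqU) (IdT EqU') where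
  map_IdT {Γ} o o' h := by
    apply ty_eq_of_u1
    have hp := fun w => congrArg Φ.F.map (𝒰.str.pair_pr (F := 𝒰.p) (ut1 o) (ut1 o') w)
    have hq := fun w => congrArg Φ.F.map (𝒰.str.pair_Q (F := 𝒰.p) (ut1 o) (ut1 o') w)
    simp only [Φ.F.map_comp] at hp hq
    rw [u1_H]
    simp only [IdT, u1_ext, Φ.F.map_comp, Category.assoc]
    rw [h0]
    simp only [← Category.assoc]
    congr 1
    apply 𝒰'.str.hom_ext
    · simp only [Category.assoc, PhiUp_pr, UnivStr.pair_pr, reassoc_of% hp, ut1_H]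
    · simp only [Category.assoc, PhiUp_Q, UnivStr.pair_Q, reassoc_of% hq, ut1_H]

theorem isJ1Hom_H (h0 : Φ.isUniv.CompatJ0 EqU EqU') {Om : UnivStr.J1 EqU}
    {Om' : UnivStr.J1 EqU'} (h1 : Φ.isUniv.CompatJ1 Om Om') :
    IsJ1Hom Φ.H (refl Om) (refl Om') where
  toIsJ0Hom := isJ0Hom_H h0
  map_refl {Γ} o := by
    apply ut1_injective
    have h1' : Φ.F.map Om.Om ≫ Φ.φt = Φ.φt ≫ Om'.Om := h1
    simp only [ut1_H, UniverseCategory.refl, ut1_tmMk, Φ.F.map_comp, Category.assoc, h1']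

/-- The isomorphism `ψ` at `IdxT(T)`, as a morphism with source `int' (IdxT'(H(T)))`: the object
`H(IdxT(T))` equals `IdxT'(H(T))`, but not definitionally. -/
noncomputable def psiIdx (h0 : Φ.isUniv.CompatJ0 EqU EqU') {Γ : 𝒰.CC} (T : Ob1 Γ) :
    𝒰'.int.obj ((IdT EqU').IdxT (Φ.H.ob1 T)).obj ⟶
      Φ.F.obj (𝒰.int.obj ((IdT EqU).IdxT T).obj) :=
  𝒰'.int.map (eqToHom ((isJ0Hom_H h0).obj_IdxT T).symm) ≫ (Φ.psiH ((IdT EqU).IdxT T).obj).hom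

variable (h0 : Φ.isUniv.CompatJ0 EqU EqU') {Γ : 𝒰.CC} (T : Ob1 Γ)

variable (Φ) in
lemma ob1_pull_proj :
    Φ.H.ob1 (pull (proj T) T) = pull (proj (Φ.H.ob1 T)) (Φ.H.ob1 T) := by
  rw [Φ.H.ob1_pull, Φ.H.map_proj]

variable (Φ) in
/-- The isomorphism `ψ` at `p_T^* T`, as a morphism with source `int' (p_{H(T)}^* H(T))`. -/
noncomputable def psiMid :
    𝒰'.int.obj (pull (proj (Φ.H.ob1 T)) (Φ.H.ob1 T)).obj ⟶
      Φ.F.obj (𝒰.int.obj (pull (proj T) T).obj) :=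
  𝒰'.int.map (eqToHom (congrArg Ob1.obj (Φ.ob1_pull_proj T)).symm) ≫
    (Φ.psiH (pull (proj T) T).obj).hom

lemma psiMid_prT : Φ.psiMid T ≫ Φ.F.map (prT (pull (proj T) T)) =
    prT (pull (proj (Φ.H.ob1 T)) (Φ.H.ob1 T)) ≫ (Φ.psiH T.obj).hom := by
  rw [psiMid, Category.assoc, ← prT_H, ← prT_congr (Φ.ob1_pull_proj T).symm, Category.assoc]

lemma psiMid_QT : Φ.psiMid T ≫ Φ.F.map (QT (pull (proj T) T)) ≫ Φ.φt =
    QT (pull (proj (Φ.H.ob1 T)) (Φ.H.ob1 T)) := by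
  rw [psiMid, Category.assoc, ← QT_H, QT_congr (Φ.ob1_pull_proj T).symm]

lemma psiMid_mid : Φ.psiMid T ≫ Φ.F.map (mid T) ≫ Φ.isUniv.PhiUp = mid (Φ.H.ob1 T) := by
  apply 𝒰'.str.hom_ext
  · simp only [Category.assoc, PhiUp_pr, mid_pr]
    rw [← Φ.F.map_comp_assoc, mid_pr, Φ.F.map_comp_assoc, ← Category.assoc, psiMid_prT,
      Category.assoc, QT_H]
  · simp only [Category.assoc, PhiUp_Q, mid_Q]
    rw [← Φ.F.map_comp_assoc, mid_Q, psiMid_QT]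

lemma psiIdx_prT : psiIdx h0 T ≫ Φ.F.map (prT ((IdT EqU).IdxT T)) =
    prT ((IdT EqU').IdxT (Φ.H.ob1 T)) ≫ Φ.psiMid T := by
  have h := prT_of_eq_pull_eqToHom _ ((isJ0Hom_H h0).ob1_IdxT T) ((isJ0Hom_H h0).obj_IdxT T)
  rw [psiIdx, Category.assoc, ← prT_H, psiMid,
    ← cancel_epi (𝒰'.int.map (eqToHom ((isJ0Hom_H h0).obj_IdxT T))),
    reassoc_of% h]
  simp only [← Functor.map_comp_assoc, eqToHom_trans, eqToHom_refl]
  simp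

lemma psiIdx_QT : psiIdx h0 T ≫ Φ.F.map (QT ((IdT EqU).IdxT T)) ≫ Φ.φt =
    QT ((IdT EqU').IdxT (Φ.H.ob1 T)) := by
  have h := QT_of_eq_pull_eqToHom _ ((isJ0Hom_H h0).ob1_IdxT T) ((isJ0Hom_H h0).obj_IdxT T)
  rw [psiIdx, Category.assoc, ← QT_H, ← h, ← Functor.map_comp_assoc]
  simp

/-- Together with `psiIdx_prE`: under `ψ`, the pull-back square of `pE'` with vertex
`int' (IdxT'(H(T)))` is the image under `(Φ, φ, φt_E)` of that of `pE` with vertex `int (IdxT(T))`. -/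
lemma psiIdx_QE : psiIdx h0 T ≫ Φ.F.map (QE EqU T) ≫ phitE h0 = QE EqU' (Φ.H.ob1 T) := by
  apply 𝒰'.str.hom_ext
  · simp only [Category.assoc, phitE_pr, QE_pr]
    rw [← Φ.F.map_comp_assoc, QE_pr, Φ.F.map_comp_assoc, ← Category.assoc, psiIdx_prT,
      Category.assoc, psiMid_mid]
  · simp only [Category.assoc, phitE_Q, QE_Q]
    rw [← Φ.F.map_comp_assoc, QE_Q, psiIdx_QT]

lemma psiIdx_prE : psiIdx h0 T ≫ Φ.F.map (prE EqU T) =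
    prE EqU' (Φ.H.ob1 T) ≫ (Φ.psiH Γ).hom := by
  simp only [prE, Φ.F.map_comp, Category.assoc]
  rw [← Category.assoc, psiIdx_prT, Category.assoc, ← Category.assoc (Φ.psiMid T), psiMid_prT,
    Category.assoc, ← prT_H]

lemma Dpre_psi_Phi2_dE {V : C} (a : 𝒰.int.obj ((IdT EqU).IdxT T).obj ⟶ V) :
    (UnivStr.E EqU').Dpre (Φ.psiH Γ).hom ((isUnivFunctorE h0).Phi2 (dE T a)) =
      dE (Φ.H.ob1 T) (psiIdx h0 T ≫ Φ.F.map a) :=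
  (isUnivFunctorE h0).Dpre_Phi2_mkD _ _ (Φ.u1_H T) _ _ (psiIdx_QE h0 T) (psiIdx_prE h0 T) a

lemma Dpre_psi_Phi2_dT {V : C} (a : 𝒰.int.obj T.obj ⟶ V) :
    𝒰'.str.Dpre (Φ.psiH Γ).hom (Φ.isUniv.Phi2 (dT T a)) =
      dT (Φ.H.ob1 T) ((Φ.psiH T.obj).hom ≫ Φ.F.map a) :=
  Φ.isUniv.Dpre_Phi2_mkD _ _ (Φ.u1_H T) _ _ (Φ.QT_H T).symm (Φ.prT_H T).symm a

section LCC

variable (L : LCCStr C) (L' : LCCStr C')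

/-- Transport along `ψ` and `χ` takes the adjoint of a morphism `a` out of `IdxT(T)` to the adjoint
of its image out of `IdxT'(H(T))`. For `k = φ` and `k = φt` this describes `ζ` and `ζt`. -/
lemma psi_map_eta_dE {V : C} {V' : C'} (a : 𝒰.int.obj ((IdT EqU).IdxT T).obj ⟶ V)
    (k : Φ.F.obj V ⟶ V') :
    (Φ.psiH Γ).hom ≫ Φ.F.map (L.eta 𝒰.isTerminal (UnivStr.E EqU) _ _ (dE T a)) ≫
        (isUnivFunctorE h0).chi L L' 𝒰.isTerminal 𝒰'.isTerminal V ≫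
        L'.Imap 𝒰'.isTerminal (UnivStr.pE EqU') k =
      L'.eta 𝒰'.isTerminal (UnivStr.E EqU') _ _
        (dE (Φ.H.ob1 T) (psiIdx h0 T ≫ Φ.F.map a ≫ k)) := by
  have h := (isUnivFunctorE h0).map_chi L L' 𝒰.isTerminal 𝒰'.isTerminal
    (L.eta 𝒰.isTerminal (UnivStr.E EqU) _ _ (dE T a))
  rw [L.etaInv_eta] at h
  rw [reassoc_of% h, ← Category.assoc, ← L'.eta_Dpre, Dpre_psi_Phi2_dE, ← L'.eta_Dmap, dE,
    UnivStr.mkD_Dmap, Category.assoc]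
  rfl

/-- The analogue of `psi_map_eta_dE` for `p` and morphisms out of `T`. For `k = φt` this describes
`ξt`. -/
lemma psi_map_eta_dT {V : C} {V' : C'} (a : 𝒰.int.obj T.obj ⟶ V) (k : Φ.F.obj V ⟶ V') :
    (Φ.psiH Γ).hom ≫ Φ.F.map (L.eta 𝒰.isTerminal 𝒰.str _ _ (dT T a)) ≫
        Φ.isUniv.chi L L' 𝒰.isTerminal 𝒰'.isTerminal V ≫ L'.Imap 𝒰'.isTerminal 𝒰'.p k =
      L'.eta 𝒰'.isTerminal 𝒰'.str _ _
        (dT (Φ.H.ob1 T) ((Φ.psiH T.obj).hom ≫ Φ.F.map a ≫ k)) := by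
  have h := Φ.isUniv.map_chi L L' 𝒰.isTerminal 𝒰'.isTerminal
    (L.eta 𝒰.isTerminal 𝒰.str _ _ (dT T a))
  rw [L.etaInv_eta] at h
  rw [reassoc_of% h, ← Category.assoc, ← L'.eta_Dpre, Dpre_psi_Phi2_dT, ← L'.eta_Dmap, dT,
    UnivStr.mkD_Dmap, Category.assoc]
  rfl

variable {L L'} {Om : UnivStr.J1 EqU} {Om' : UnivStr.J1 EqU'} (h1 : Φ.isUniv.CompatJ1 Om Om')

/-- The morphisms `φ(Γ, T, P, s0)` classifying the data of the eliminator correspond under `H`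
and `R`. -/
lemma psi_map_phiJ_R (P : Ob1 ((IdT EqU).IdxT T).obj) (s0 : Tm T.obj)
    (h : s0.ty = pull ((refl Om).rf T) P) :
    (Φ.psiH Γ).hom ≫ Φ.F.map (phiJ L T P s0 h) ≫
        R L L' 𝒰.isTerminal 𝒰'.isTerminal h0 h1 =
      phiJ L' (Φ.H.ob1 T) ((Φ.H.ob1 P).cast ((isJ0Hom_H h0).obj_IdxT T)) (Φ.H.tm s0)
        ((isJ1Hom_H h0 h1).ty_tm T P s0 h) := by
  apply L'.hom_ext
  · simp only [Category.assoc, R, phiJ, LCCStr.lift_fst]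
    rw [← Φ.F.map_comp_assoc, LCCStr.lift_fst, zeta, psi_map_eta_dE,
      u1_cast ((isJ0Hom_H h0).obj_IdxT T), u1_H, psiIdx, Category.assoc]
  · simp only [Category.assoc, R, phiJ, LCCStr.lift_snd]
    rw [← Φ.F.map_comp_assoc, LCCStr.lift_snd, xit, psi_map_eta_dT, ut1_H]

theorem isJ2Hom_H {S : UnivStr.J2 L 𝒰.isTerminal Om} {S' : UnivStr.J2 L' 𝒰'.isTerminal Om'}
    (h2 : CompatJ2 L L' 𝒰.isTerminal 𝒰'.isTerminal h0 h1 S S') :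
    IsJ2Hom Φ.H (J S) (J S') where
  toIsJ1Hom := isJ1Hom_H h0 h1
  map_J {Γ} T P s0 h := by
    apply ut1_injective
    apply UnivStr.mkD_injective (UnivStr.E EqU') (sqE EqU' (Φ.H.ob1 T))
    apply (L'.eta 𝒰'.isTerminal (UnivStr.E EqU') _ _).injective
    refine Eq.trans ?_ (eta_secJ S' (Φ.H.ob1 T) _ _ _).symm
    -- The compatibility condition with `ζt` unfolded, to match `psi_map_eta_dE`.
    have h2' : Φ.F.map S.Jp ≫ (isUnivFunctorE h0).chi L L' 𝒰.isTerminal 𝒰'.isTerminal 𝒰.Ut ≫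
        L'.Imap 𝒰'.isTerminal (UnivStr.pE EqU') Φ.φt =
        R L L' 𝒰.isTerminal 𝒰'.isTerminal h0 h1 ≫ S'.Jp := h2
    have e := psi_map_eta_dE h0 T L L' (ut1 (secJ S T P s0 h)) Φ.φt
    rw [eta_secJ, Φ.F.map_comp, Category.assoc, h2', ← Category.assoc, ← Category.assoc,
      Category.assoc (Φ.psiH Γ).hom, psi_map_phiJ_R] at e
    rw [e, ut1_cast, ut1_H, psiIdx, Category.assoc]
    rfl

end LCC

end UniverseFunctor

theorem lemma2015p04p12 {C : Type u} [Category.{v} C] {C' : Type u'} [Category.{v'} C']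
    (𝒰 : UniverseCategory C) (𝒰' : UniverseCategory C') (Φ : UniverseFunctor 𝒰 𝒰')
    (EqU : 𝒰.str.J0) (EqU' : 𝒰'.str.J0) (h0 : Φ.isUniv.CompatJ0 EqU EqU') :
    CSystem.IsJ0Hom Φ.H (UniverseCategory.IdT EqU) (UniverseCategory.IdT EqU') ∧
    (∀ (Om : UnivStr.J1 EqU) (Om' : UnivStr.J1 EqU'), Φ.isUniv.CompatJ1 Om Om' →
      CSystem.IsJ1Hom Φ.H (UniverseCategory.refl Om) (UniverseCategory.refl Om')) ∧
    (∀ (Om : UnivStr.J1 EqU) (Om' : UnivStr.J1 EqU') (h1 : Φ.isUniv.CompatJ1 Om Om')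
      (L : LCCStr C) (L' : LCCStr C') (S : UnivStr.J2 L 𝒰.isTerminal Om)
      (S' : UnivStr.J2 L' 𝒰'.isTerminal Om'),
      IsUnivFunctor.CompatJ2 L L' 𝒰.isTerminal 𝒰'.isTerminal h0 h1 S S' →
      CSystem.IsJ2Hom Φ.H (UniverseCategory.J S) (UniverseCategory.J S')) :=
  ⟨UniverseFunctor.isJ0Hom_H h0, fun _ _ h1 => UniverseFunctor.isJ1Hom_H h0 h1,
    fun _ _ h1 _ _ _ _ h2 => UniverseFunctor.isJ2Hom_H h0 h1 h2⟩
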